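/- Let $T^A$ ($A=1,\dots,8$) be the generators of $SU(3)$ in the fundamental representation, with $\mathrm{tr}(T^AT^B)=\tfrac12\delta_{AB}$. Let $a_A,a_A^\dagger$ be bosonic and $f_A,f_A^\dagger$ fermionic annihilation and creation operators, $|0\rangle$ the Fock vacuum, $a=a_AT^A$, $a^\dagger=a^\dagger_AT^A$, $f^\dagger=f^\dagger_AT^A$ the operator-valued matrices, and $(O)=\mathrm{tr}\,O$. Let $$H=(a^\dagger a)+2-\tfrac12(a^\dagger a^\dagger)-\tfrac12(aa).$$ For the two fermionic bricks $C_1^\dagger=(f^\dagger a^\dagger)$ and $C_2^\dagger=(f^\dagger a^\dagger a^\dagger)$ put $|j,k;b\rangle=C_b^\dagger\,(a^\dagger a^\dagger)^j(a^\dagger a^\dagger a^\dagger)^k|0\rangle$, a state with $2j+3k+b$ bosonic quanta. For $N\in\mathbb N$ let $\mathcal H_N$ be the span of the states with $2j+3k+b\le N$, and let $H_N$ be the cut Hamiltonian on $\mathcal H_N$, that is, $H$ followed by the projection onto the states with at most $N$ bosonic quanta. Let $L_n^\alpha=\mathcal L_n^\alpha/\Gamma(n+\alpha+1)$, where $\mathcal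 L_n^\alpha$ is the generalized Laguerre polynomial. For the parity "odd" let $b_t=1$ for even $t$ and $b_t=2$ for odd $t$; for the parity "even" let $b_t=2$ for even $t$ and $b_t=1$ for odd $t$. Put $\alpha_t=3t+3+b_t$, $\chi_t=-\tfrac12(t+1)$ if $b_t=1$ and $\chi_t=-\tfrac32(t+1)$ if $b_t=2$, $\mu_t=-\tfrac38(t+1)(t+2)$, and define the mixing coefficients of the given parity by $\Gamma_{m,y}=0$ for $y>m$, $\Gamma_{m,m}=1$ and $$\Gamma_{m,y}=\frac{4(\chi_y\Gamma_{m,y+1}+\mu_y\Gamma_{m,y+2})}{\alpha_m^2-\alpha_y^2}\qquad(y<m).$$ Consider, for $\kappa\ge0$, the families $g^1_\kappa,g^2_\kappa$ (odd parity) and $f^1_\kappa,f^2_\kappa$ (even parity). A state belongs to a family if it is a combination of states $|j,k;b\rangle$ whose number of bosonic quanta has the parity of the family, the maximal number $k$ of cubic bricks occurring in it is $2\kappa,\ 2\kappa+1,\ 2\kappa+1,\ 2\kappa$, respectively, and the basis states with this maximal $k$ have the brick $(f^\dagger a^\dagger)$, $(f^\dagger a^\dagger a^\dagger)$, $(f^\dagger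 a^\dagger)$, $(f^\dagger a^\dagger a^\dagger)$, respectively. Let the upper index be $\alpha=6\kappa+4,\ 6\kappa+8,\ 6\kappa+7,\ 6\kappa+5$, the exponent $\nu=3\kappa+\tfrac12,\ 3\kappa+\tfrac52,\ 3\kappa+2,\ 3\kappa+1$ and $d=\max\big(0,\lfloor\tfrac12(N-6\kappa-c)\rfloor+1\big)$ with $c=1,5,4,2$, respectively. Put $$|E,\kappa\rangle=(2E)^{\nu}e^{-E}\sum_{n=0}^{d-1}L_n^{\alpha}(2E)\,\overline{|n\rangle},$$ where $\overline{|n\rangle}$ is, for $g^1_\kappa,g^2_\kappa,f^1_\kappa,f^2_\kappa$ respectively, $$|n,2\kappa;1\rangle+\sum_{p=1}^{\kappa}\Big(\Gamma^{odd}_{2\kappa,2\kappa-2p+1}|n+3p-2,2\kappa-2p+1;2\rangle+\Gamma^{odd}_{2\kappa,2\kappa-2p}|n+3p,2\kappa-2p;1\rangle\Big),$$ $$|n,2\kappa+1;2\rangle+\sum_{p=1}^{\kappa+1}\Gamma^{odd}_{2\kappa+1,2\kappa-2p+2}|n+3p-1,2\kappa-2p+2;1\rangle+\sum_{p=1}^{\kappa}\Gamma^{odd}_{2\kappa+1,2\kappa-2p+1}|n+3p,2\kappa-2p+1;2\rangle,$$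 $$|n,2\kappa+1;1\rangle+\sum_{p=0}^{\kappa}\Gamma^{even}_{2\kappa+1,2\kappa-2p}|n+3p+1,2\kappa-2p;2\rangle+\sum_{p=1}^{\kappa}\Gamma^{even}_{2\kappa+1,2\kappa-2p+1}|n+3p,2\kappa-2p+1;1\rangle,$$ $$|n,2\kappa;2\rangle+\sum_{p=1}^{\kappa}\Big(\Gamma^{even}_{2\kappa,2\kappa-2p+1}|n+3p-1,2\kappa-2p+1;1\rangle+\Gamma^{even}_{2\kappa,2\kappa-2p}|n+3p,2\kappa-2p;2\rangle\Big).$$ Then, for every cut-off $N$: (1) The states $|j,k;b\rangle$ are linearly independent. (2) In every family the quantization condition $L_d^{\alpha}(2E)=0$ has exactly $d$ distinct real solutions $E_1,\dots,E_d$, all positive. For each of them $|E_m,\kappa\rangle$ is an eigenstate of $H_N$ with energy $E_m$ and belongs to the family. Conversely, the energy of any eigenstate of $H_N$ that belongs to the family satisfies the quantization condition of the family. (3) The states $|E_m,\kappa\rangle$ of all families together form a basis of $\mathcal H_N$, and every eigenstate of $H_N$ with energy $E$ is a linear combination of those among them that have energy $E$. (4) The spectrum of $H_N$, that is, the set of all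 $E\in\mathbb C$ for which a nonzero eigenstate exists, is the set of roots of $$\Theta_N(E)=\Big[\prod_{j=0}^{\lfloor (N-1)/3\rfloor}L^{3j+4}_{\lfloor (N-3j-1)/2\rfloor+1}(2E)\Big]\Big[\prod_{k=0}^{\lfloor (N-2)/3\rfloor}L^{3k+5}_{\lfloor (N-3k-2)/2\rfloor+1}(2E)\Big],$$ where a product with a negative upper limit is $1$. -/

import Mathlib

/-- The generators `T^A = λ_A / 2` of `SU(3)` in the fundamental representation (`λ_A` the
Gell-Mann matrices), normalised by `tr (T^A T^B) = δ_{AB} / 2`. -/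
noncomputable def generator : Fin 8 → Matrix (Fin 3) (Fin 3) ℂ :=
  ![(1 / 2 : ℂ) • !![0, 1, 0; 1, 0, 0; 0, 0, 0],
    (1 / 2 : ℂ) • !![0, -Complex.I, 0; Complex.I, 0, 0; 0, 0, 0],
    (1 / 2 : ℂ) • !![1, 0, 0; 0, -1, 0; 0, 0, 0],
    (1 / 2 : ℂ) • !![0, 0, 1; 0, 0, 0; 1, 0, 0],
    (1 / 2 : ℂ) • !![0, 0, -Complex.I; 0, 0, 0; Complex.I, 0, 0],
    (1 / 2 : ℂ) • !![0, 0, 0; 0, 0, 1; 0, 1, 0],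
    (1 / 2 : ℂ) • !![0, 0, 0; 0, 0, -Complex.I; 0, Complex.I, 0],
    (1 / (2 * Real.sqrt 3 : ℝ) : ℂ) • !![1, 0, 0; 0, 1, 0; 0, 0, -2]]

/-- States with finitely many quanta of the eight bosonic oscillators: the polynomial `p` is the
state `p(a†)|0⟩`. Thus `a†_A` is multiplication by the variable `X_A`, `a_A` is `∂/∂X_A`, and the
Fock vacuum is `1`. -/
abbrev BosonFock : Type := MvPolynomial (Fin 8) ℂ

/-- The sector with one fermion: the tuple `ψ` is the state `∑_A f†_A ψ_A(a†)|0⟩`. -/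
abbrev OneFermionFock : Type := Fin 8 → BosonFock

/-- The bosonic creation operator `a†_A` on the one-fermion sector. -/
noncomputable def creationOp (A : Fin 8) : Module.End ℂ OneFermionFock :=
  (LinearMap.mulLeft ℂ (MvPolynomial.X A : BosonFock)).compLeft (Fin 8)

/-- The bosonic annihilation operator `a_A` on the one-fermion sector. -/
noncomputable def annihilationOp (A : Fin 8) : Module.End ℂ OneFermionFock :=
  (MvPolynomial.pderiv (R := ℂ) A).toLinearMap.compLeft (Fin 8)

/-- The operator-valued matrix `a†_{ij} = a†_A T^A_{ij}`. -/
noncomputable def creationMatrix : Matrix (Fin 3) (Fin 3) (Module.End ℂ OneFermionFock) :=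
  Matrix.of fun i j => ∑ A, generator A i j • creationOp A

/-- The operator-valued matrix `a_{ij} = a_A T^A_{ij}`. -/
noncomputable def annihilationMatrix : Matrix (Fin 3) (Fin 3) (Module.End ℂ OneFermionFock) :=
  Matrix.of fun i j => ∑ A, generator A i j • annihilationOp A

/-- The Hamiltonian `H = tr(a†a) + 2 - tr(a†a†)/2 - tr(aa)/2` on the one-fermion sector. -/
noncomputable def hamiltonian : Module.End ℂ OneFermionFock :=
  (creationMatrix * annihilationMatrix).trace + (2 : ℂ) • 1
    - (1 / 2 : ℂ) • (creationMatrix * creationMatrix).trace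
    - (1 / 2 : ℂ) • (annihilationMatrix * annihilationMatrix).trace

/-- The orthogonal projection of the one-fermion sector onto the states with at most `N` bosonic
quanta. -/
noncomputable def quantaCutoff (N : ℕ) : Module.End ℂ OneFermionFock :=
  (∑ i ∈ Finset.range (N + 1),
    (MvPolynomial.homogeneousComponent i : BosonFock →ₗ[ℂ] BosonFock)).compLeft (Fin 8)

/-- The two fermionic bricks with one fermion, `(f†a†)` and `(f†a†a†)`. -/
inductive FermionicBrick : Type
  | fa
  | faa

/-- The number of bosonic creation operators in a fermionic brick. -/
def FermionicBrick.bosons : FermionicBrick → ℕ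
  | .fa => 1
  | .faa => 2

/-- The matrix `a†_{ij}` as a matrix of polynomials in the creation operators. -/
noncomputable def brickMatrix : Matrix (Fin 3) (Fin 3) BosonFock :=
  Matrix.of fun i j => ∑ A, MvPolynomial.C (generator A i j) * MvPolynomial.X A

/-- The state `C† (a†a†)^j (a†a†a†)^k |0⟩`, where `C†` is the fermionic brick `b`; the coefficient
of `f†_A` in the brick `(f† a† ⋯ a†)` is `tr (T^A a† ⋯ a†)`. -/
noncomputable def brickState (b : FermionicBrick) (j k : ℕ) : OneFermionFock := fun A =>
  ((generator A).map MvPolynomial.C * brickMatrix ^ b.bosons).trace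
    * (brickMatrix ^ 2).trace ^ j * (brickMatrix ^ 3).trace ^ k

/-- The number of bosonic quanta of `brickState b j k`. -/
def brickQuanta (b : FermionicBrick) (j k : ℕ) : ℕ := 2 * j + 3 * k + b.bosons

/-- The one-fermion state space at cut-off `N`. -/
noncomputable def cutSpace (N : ℕ) : Submodule ℂ OneFermionFock :=
  Submodule.span ℂ {ψ | ∃ b j k, brickQuanta b j k ≤ N ∧ ψ = brickState b j k}

/-- `ψ` is an eigenstate, of energy `E`, of the Hamiltonian restricted to the cut-off space. -/
def IsCutEigenstate (N : ℕ) (E : ℂ) (ψ : OneFermionFock) : Prop :=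
  ψ ∈ cutSpace N ∧ ψ ≠ 0 ∧ quantaCutoff N (hamiltonian ψ) = E • ψ

/-- The generalized Laguerre polynomial of degree `n` and upper index `α`. -/
noncomputable def laguerrePoly (α n : ℕ) : Polynomial ℝ :=
  ∑ i ∈ Finset.range (n + 1),
    Polynomial.C ((-1) ^ i * ((n + α).choose (n - i) : ℝ) / (i.factorial : ℝ)) * Polynomial.X ^ i

/-- The rescaled Laguerre polynomial `L_n^α`, the Laguerre polynomial divided by `Γ(n + α + 1)`. -/
noncomputable def soninePoly (α n : ℕ) : Polynomial ℝ :=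
  Polynomial.C (1 / ((n + α).factorial : ℝ)) * laguerrePoly α n

/-- The parity of the number of bosonic quanta. -/
inductive QuantaParity : Type
  | odd
  | even

/-- The fermionic brick that accompanies `t` cubic bricks in a state of given parity. -/
def chainBrick (P : QuantaParity) (t : ℕ) : FermionicBrick :=
  match P with
  | .odd => if Even t then .fa else .faa
  | .even => if Even t then .faa else .fa

/-- The Laguerre index `α_t`. -/
def chainIndex (P : QuantaParity) (t : ℕ) : ℕ := 3 * t + 3 + (chainBrick P t).bosons

/-- The nearest-neighbour mixing `χ_t`. -/
noncomputable def chainChi (P : QuantaParity) (t : ℕ) : ℝ :=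
  match chainBrick P t with
  | .fa => -(1 / 2) * (t + 1)
  | .faa => -(3 / 2) * (t + 1)

/-- The next-to-nearest-neighbour mixing `μ_t`. -/
noncomputable def chainMu (t : ℕ) : ℝ := -(3 / 8) * (t + 1) * (t + 2)

/-- The mixing coefficients `Γ_{m,y}`: they vanish for `y > m`, equal `1` for `y = m`, and
`Γ_{m,y} = 4 (χ_y Γ_{m,y+1} + μ_y Γ_{m,y+2}) / (α_m² - α_y²)` for `y < m`. -/
noncomputable def mixing (P : QuantaParity) (m y : ℕ) : ℝ :=
  if m < y then 0
  else if y = m then 1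
  else 4 * (chainChi P y * mixing P m (y + 1) + chainMu y * mixing P m (y + 2))
    / ((chainIndex P m : ℝ) ^ 2 - (chainIndex P y : ℝ) ^ 2)
termination_by m + 1 - y

/-- The four types of families: `g¹, g²` (odd number of quanta) and `f¹, f²` (even number). -/
inductive FamilyType : Type
  | g1
  | g2
  | f1
  | f2

namespace FamilyType

/-- The parity of the number of quanta in a family. -/
def parity : FamilyType → QuantaParity
  | g1 => .odd
  | g2 => .odd
  | f1 => .even
  | f2 => .even

/-- The maximal number of cubic bricks in the family with label `κ`. -/
def maxCubic : FamilyType → ℕ → ℕ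
  | g1, κ => 2 * κ
  | g2, κ => 2 * κ + 1
  | f1, κ => 2 * κ + 1
  | f2, κ => 2 * κ

/-- The fermionic brick of the basis states with the maximal number of cubic bricks. -/
def leadingBrick : FamilyType → FermionicBrick
  | g1 => .fa
  | g2 => .faa
  | f1 => .fa
  | f2 => .faa

/-- The upper index of the Laguerre polynomials of the family with label `κ`. -/
def upperIndex : FamilyType → ℕ → ℕ
  | g1, κ => 6 * κ + 4
  | g2, κ => 6 * κ + 8
  | f1, κ => 6 * κ + 7
  | f2, κ => 6 * κ + 5

/-- The power of `2E` in the normalisation. -/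
noncomputable def normExponent : FamilyType → ℕ → ℝ
  | g1, κ => 3 * κ + 1 / 2
  | g2, κ => 3 * κ + 5 / 2
  | f1, κ => 3 * κ + 2
  | f2, κ => 3 * κ + 1

/-- The number of solutions in the family with label `κ` at cut-off `N`, with `0` in place of a
negative value. -/
def solutionCount (N : ℕ) : FamilyType → ℕ → ℕ
  | g1, κ => (((N : ℤ) - 6 * κ - 1) / 2 + 1).toNat
  | g2, κ => (((N : ℤ) - 6 * κ - 5) / 2 + 1).toNat
  | f1, κ => (((N : ℤ) - 6 * κ - 4) / 2 + 1).toNat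
  | f2, κ => (((N : ℤ) - 6 * κ - 2) / 2 + 1).toNat

/-- The combination of basis states that multiplies `L_n(2E)` in the family with label `κ`. -/
noncomputable def dressedState : FamilyType → ℕ → ℕ → OneFermionFock
  | g1, κ, n => brickState .fa n (2 * κ)
      + ∑ p ∈ Finset.Icc 1 κ,
        ((mixing .odd (2 * κ) (2 * κ - 2 * p + 1) : ℂ) •
            brickState .faa (n + 3 * p - 2) (2 * κ - 2 * p + 1)
          + (mixing .odd (2 * κ) (2 * κ - 2 * p) : ℂ) •
            brickState .fa (n + 3 * p) (2 * κ - 2 * p))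
  | g2, κ, n => brickState .faa n (2 * κ + 1)
      + ∑ p ∈ Finset.Icc 1 (κ + 1),
        (mixing .odd (2 * κ + 1) (2 * κ + 2 - 2 * p) : ℂ) •
          brickState .fa (n + 3 * p - 1) (2 * κ + 2 - 2 * p)
      + ∑ p ∈ Finset.Icc 1 κ,
        (mixing .odd (2 * κ + 1) (2 * κ - 2 * p + 1) : ℂ) •
          brickState .faa (n + 3 * p) (2 * κ - 2 * p + 1)
  | f1, κ, n => brickState .fa n (2 * κ + 1)
      + ∑ p ∈ Finset.Icc 0 κ,
        (mixing .even (2 * κ + 1) (2 * κ - 2 * p) : ℂ) •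
          brickState .faa (n + 3 * p + 1) (2 * κ - 2 * p)
      + ∑ p ∈ Finset.Icc 1 κ,
        (mixing .even (2 * κ + 1) (2 * κ - 2 * p + 1) : ℂ) •
          brickState .fa (n + 3 * p) (2 * κ - 2 * p + 1)
  | f2, κ, n => brickState .faa n (2 * κ)
      + ∑ p ∈ Finset.Icc 1 κ,
        ((mixing .even (2 * κ) (2 * κ - 2 * p + 1) : ℂ) •
            brickState .fa (n + 3 * p - 1) (2 * κ - 2 * p + 1)
          + (mixing .even (2 * κ) (2 * κ - 2 * p) : ℂ) •
            brickState .faa (n + 3 * p) (2 * κ - 2 * p))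

/-- The energies allowed by the quantization condition `L_d^α(2E) = 0` of the family with label
`κ` at cut-off `N`, where `d` is the number of solutions. -/
def energies (N : ℕ) (F : FamilyType) (κ : ℕ) : Set ℝ :=
  {E | (soninePoly (F.upperIndex κ) (F.solutionCount N κ)).eval (2 * E) = 0}

/-- The state of energy `E` in the family with label `κ` at cut-off `N`. -/
noncomputable def eigenstate (N : ℕ) (F : FamilyType) (κ : ℕ) (E : ℝ) : OneFermionFock :=
  (((2 * E) ^ F.normExponent κ * Real.exp (-E) : ℝ) : ℂ) •
    ∑ n ∈ Finset.range (F.solutionCount N κ),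
      (((soninePoly (F.upperIndex κ) n).eval (2 * E) : ℝ) : ℂ) • F.dressedState κ n

/-- `ψ` is composed of basis states whose number of quanta has the parity of the family, the
maximal number of cubic bricks in them is that of the family, and the basis states with this
number of cubic bricks contain the leading fermionic brick of the family. -/
def Contains (F : FamilyType) (κ : ℕ) (ψ : OneFermionFock) : Prop :=
  ∃ c : FermionicBrick × ℕ × ℕ →₀ ℂ,
    ψ = c.sum (fun s x => x • brickState s.1 s.2.1 s.2.2) ∧
    (∀ s ∈ c.support,
      (match F.parity with
        | .odd => Odd (brickQuanta s.1 s.2.1 s.2.2)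
        | .even => Even (brickQuanta s.1 s.2.1 s.2.2)) ∧
      s.2.2 ≤ F.maxCubic κ ∧
      (s.2.2 = F.maxCubic κ → s.1 = F.leadingBrick)) ∧
    ∃ s ∈ c.support, s.2.2 = F.maxCubic κ

end FamilyType

/-- The set of all solutions at cut-off `N`: a family and an energy allowed in it. -/
abbrev CutSolution (N : ℕ) : Type :=
  {s : FamilyType × ℕ × ℝ // s.2.2 ∈ s.1.energies N s.2.1}

/-- The polynomial `Θ_N(E)` of the one-fermion sector. -/
noncomputable def thetaPoly (N : ℕ) : Polynomial ℝ :=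
  (∏ j ∈ Finset.range (((N : ℤ) - 1) / 3 + 1).toNat,
    (soninePoly (3 * j + 4) (((N : ℤ) - 3 * j - 1) / 2 + 1).toNat).comp
      (Polynomial.C 2 * Polynomial.X)) *
  (∏ k ∈ Finset.range (((N : ℤ) - 2) / 3 + 1).toNat,
    (soninePoly (3 * k + 5) (((N : ℤ) - 3 * k - 2) / 2 + 1).toNat).comp
      (Polynomial.C 2 * Polynomial.X))

/-!
A one-fermion state has eight components, one for each `f†_A`, which are polynomials in the eight
variables `a†_A`, and `(aa)` acts on each of them as a multiple of the Laplacian. The Fierz identity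
of `SU(3)` and the Cayley–Hamilton identity for the colour matrix `a†` reduce every gradient that
occurs to the bricks, so that the Laplacian of a state `|j,k;b⟩` is a combination of such states
with as many or fewer cubic bricks. The mixing coefficients remove the terms with fewer cubic
bricks: on each chain of dressed states `|n,m⟩ + …` with fixed `m` the Laplacian lowers `n` by one
and `(a†a†)` raises it by one.

On such a chain `H` is therefore the Jacobi matrix of the polynomials `L_n^α(2E)`. For a combination
of the first `d` states with coefficients `L_n^α(2E)`, the cut removes the component of `H ψ` above
the cut-off, and the recurrence in the last component kept lacks only a multiple of `L_d^α(2E)`;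
hence the quantization condition. By the Christoffel–Darboux formula the roots are real and simple,
so each chain has a basis of eigenstates. The dressing is unitriangular with respect to the number
of cubic bricks, so the chains together form a basis of the cut-off space, and the eigenstates of
all chains do as well.
-/

section SumIcc

variable {M : Type*} [AddCommMonoid M] (f : ℕ → M) (n : ℕ)

theorem sum_Icc_one_reflect : ∑ p ∈ Finset.Icc 1 n, f (n - p) = ∑ i ∈ Finset.range n, f i := by
  rw [← Finset.sum_range_reflect, ← Finset.Ico_add_one_right_eq_Icc,
    Finset.sum_Ico_eq_sum_range]
  exact Finset.sum_congr (by simp) fun i _ ↦ by rw [Nat.sub_sub]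

theorem sum_range_two_mul_reflect :
    ∑ i ∈ Finset.range (2 * n), f i =
      ∑ p ∈ Finset.Icc 1 n, (f (2 * n - 2 * p + 1) + f (2 * n - 2 * p)) := by
  simp only [← Nat.mul_sub]
  rw [sum_Icc_one_reflect (fun q ↦ f (2 * q + 1) + f (2 * q))]
  induction n with
  | zero => simp
  | succ n ih =>
    rw [Nat.mul_succ, Finset.sum_range_succ, Finset.sum_range_succ, ih, Finset.sum_range_succ,
      add_assoc, add_comm (f _)]

theorem sum_range_two_mul_add_one_reflect :
    ∑ i ∈ Finset.range (2 * n + 1), f i =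
      ∑ p ∈ Finset.Icc 0 n, f (2 * n - 2 * p) + ∑ p ∈ Finset.Icc 1 n, f (2 * n - 2 * p + 1) := by
  rw [Finset.sum_range_succ, sum_range_two_mul_reflect, Finset.sum_add_distrib,
    ← Finset.add_sum_Ioc_eq_sum_Icc n.zero_le, ← Finset.Icc_add_one_left_eq_Ioc, zero_add,
    mul_zero, Nat.sub_zero]
  abel

theorem sum_Icc_one_succ_reflect :
    ∑ p ∈ Finset.Icc 1 (n + 1), f (2 * n + 2 - 2 * p) =
      ∑ p ∈ Finset.Icc 0 n, f (2 * n - 2 * p) := by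
  simp only [← Finset.Ico_add_one_right_eq_Icc]
  rw [← Finset.sum_Ico_add' _ 0 (n + 1) 1]
  simp only [Nat.mul_succ, Nat.add_sub_add_right]

end SumIcc

section Unitriangular

open Submodule

variable {R V ι α : Type*} [Ring R] [AddCommGroup V] [Module R V] [LinearOrder α]
  {v w : ι → V} (r : ι → α)

theorem linearIndependent_of_sub_mem_span_lt (hv : LinearIndependent R v)
    (h : ∀ i, w i - v i ∈ span R (v '' {j | r j < r i})) : LinearIndependent R w := by
  simp only [Finsupp.mem_span_image_iff_linearCombination] at h
  choose e he hew using h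
  have hw (i : ι) : w i = Finsupp.linearCombination R v (Finsupp.single i 1 + e i) := by
    rw [map_add, hew, Finsupp.linearCombination_single, one_smul, add_sub_cancel]
  rw [linearIndependent_iff]
  intro g hg
  by_contra hne
  obtain ⟨i₀, hi₀, hmax⟩ := g.support.exists_max_image r (Finsupp.support_nonempty_iff.2 hne)
  have he₀ (i : ι) (hi : i ∈ g.support) : e i i₀ = 0 :=
    Finsupp.notMem_support_iff.1 fun hmem ↦ ((he i hmem).trans_le (hmax i hi)).false
  have hzero : g.sum (fun i x ↦ x • (Finsupp.single i 1 + e i)) = 0 := by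
    refine linearIndependent_iff.1 hv _ ?_
    rw [Finsupp.linearCombination_apply, Finsupp.sum] at hg
    simpa only [Finsupp.sum, map_sum, map_smul, ← hw] using hg
  have hcoeff := DFunLike.congr_fun hzero i₀
  rw [Finsupp.sum, Finsupp.finsetSum_apply, Finset.sum_eq_single_of_mem i₀ hi₀
    fun i hi hne ↦ by simp [he₀ i hi, hne]] at hcoeff
  exact Finsupp.mem_support_iff.1 hi₀ (by simpa [he₀ i₀ hi₀] using hcoeff)

theorem span_image_eq_of_sub_mem_span_lt [WellFoundedLT α] {S : Set ι}
    (h : ∀ i ∈ S, w i - v i ∈ span R (v '' {j | j ∈ S ∧ r j < r i})) :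
    span R (w '' S) = span R (v '' S) := by
  apply le_antisymm <;> rw [span_le]
  · rintro _ ⟨i, hi, rfl⟩
    rw [← sub_add_cancel (w i) (v i)]
    exact add_mem (span_mono (Set.image_mono fun j hj ↦ hj.1) (h i hi))
      (subset_span ⟨i, hi, rfl⟩)
  · rintro _ ⟨i, hi, rfl⟩
    induction hr : r i using WellFoundedLT.induction generalizing i with
    | ind a ih =>
      rw [← sub_sub_cancel (w i) (v i)]
      refine sub_mem (subset_span ⟨i, hi, rfl⟩) (span_le.2 ?_ (h i hi))
      rintro _ ⟨j, ⟨hj, hlt⟩, rfl⟩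
      exact ih (r j) (hr ▸ hlt) j hj rfl

theorem linearCombination_mem_span_image_iff (hv : LinearIndependent R v) {S : Set ι}
    {l : ι →₀ R} :
    Finsupp.linearCombination R v l ∈ span R (v '' S) ↔ ↑l.support ⊆ S := by
  rw [Finsupp.span_image_eq_map_linearCombination, ← Finsupp.mem_supported R]
  exact Function.Injective.mem_set_image (f := Finsupp.linearCombination R v) hv

theorem span_image_inf_span_image (hv : LinearIndependent R v) (S T : Set ι) :
    span R (v '' S) ⊓ span R (v '' T) = span R (v '' (S ∩ T)) := by
  simp only [Finsupp.span_image_eq_map_linearCombination, Finsupp.supported_inter,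
    Submodule.map_inf _ hv]

end Unitriangular

theorem mem_span_image_of_apply_eq_smul {R M ι : Type*} [CommRing R] [NoZeroDivisors R]
    [AddCommGroup M] [Module R M] {T : Module.End R M} {v : ι → M} {μ : ι → R} {x : M} {c : R}
    (hv : LinearIndependent R v) (hT : ∀ i, T (v i) = μ i • v i)
    (hx : x ∈ Submodule.span R (Set.range v)) (hTx : T x = c • x) :
    x ∈ Submodule.span R (v '' {i | μ i = c}) := by
  obtain ⟨g, rfl⟩ := Finsupp.mem_span_range_iff_exists_finsupp.1 hx
  have hzero : ∑ i ∈ g.support, (g i * (μ i - c)) • v i = 0 := by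
    rw [Finsupp.sum, map_sum, Finset.smul_sum, ← sub_eq_zero, ← Finset.sum_sub_distrib] at hTx
    rw [← hTx]
    refine Finset.sum_congr rfl fun i _ ↦ ?_
    rw [map_smul, hT]
    module
  refine Submodule.sum_mem _ fun i hi ↦ Submodule.smul_mem _ _ (Submodule.subset_span ⟨i, ?_, rfl⟩)
  exact sub_eq_zero.1 ((mul_eq_zero.1 (linearIndependent_iff'.1 hv _ _ hzero i hi)).resolve_left
    (Finsupp.mem_support_iff.1 hi))

section OrthogonalPolynomials

open Polynomial

/-- The three-term recurrence of a sequence of orthogonal polynomials, normalised so that the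
coefficient of the preceding polynomial is `1`. -/
structure ThreeTermRecurrence {R : Type*} [CommRing R] (p : ℕ → R[X]) (a b : ℕ → R) : Prop where
  zero : C (b 0) * p 1 = (C (a 0) - X) * p 0
  succ (n : ℕ) : C (b (n + 1)) * p (n + 2) = (C (a (n + 1)) - X) * p (n + 1) - p n

namespace ThreeTermRecurrence

theorem christoffel_darboux {R A : Type*} [CommRing R] [CommRing A] [Algebra R A]
    {p : ℕ → R[X]} {a b : ℕ → R} (h : ThreeTermRecurrence p a b) (x y : A) (d : ℕ) :
    (x - y) * ∑ n ∈ Finset.range (d + 1),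
        algebraMap R A (∏ i ∈ Finset.range n, b i) * (aeval x (p n) * aeval y (p n)) =
      algebraMap R A (∏ i ∈ Finset.range (d + 1), b i) *
        (aeval x (p d) * aeval y (p (d + 1)) - aeval x (p (d + 1)) * aeval y (p d)) := by
  induction d with
  | zero =>
    have recurrence (z : A) := congrArg (aeval z) h.zero
    simp only [map_mul, map_sub, aeval_C, aeval_X] at recurrence
    simp only [zero_add, Finset.sum_range_one, Finset.prod_range_zero, Finset.prod_range_one,
      map_one]
    linear_combination aeval y (p 0) * recurrence x - aeval x (p 0) * recurrence y
  | succ d ih =>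
    have recurrence (z : A) := congrArg (aeval z) (h.succ d)
    simp only [map_mul, map_sub, aeval_C, aeval_X] at recurrence
    rw [Finset.sum_range_succ, mul_add, ih, Finset.prod_range_succ _ (d + 1), map_mul]
    linear_combination algebraMap R A (∏ i ∈ Finset.range (d + 1), b i) *
      (aeval y (p (d + 1)) * recurrence x - aeval x (p (d + 1)) * recurrence y)

variable {p : ℕ → ℝ[X]} {a b : ℕ → ℝ} {c : ℝ}

theorem sum_normSq_pos (hb : ∀ n, 0 < b n) (hc : c ≠ 0) (hp : p 0 = C c) (z : ℂ) (d : ℕ) :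
    0 < ∑ n ∈ Finset.range (d + 1),
      (∏ i ∈ Finset.range n, b i) * Complex.normSq (aeval z (p n)) := by
  rw [Finset.sum_range_succ']
  refine add_pos_of_nonneg_of_pos (Finset.sum_nonneg fun n _ ↦ mul_nonneg
    (Finset.prod_nonneg fun i _ ↦ (hb i).le) (Complex.normSq_nonneg _)) ?_
  simpa [hp] using hc

theorem aeval_zero_ne_zero (hc : c ≠ 0) (hp : p 0 = C c) (z : ℂ) : aeval z (p 0) ≠ 0 := by
  simpa [hp] using hc

theorem conj_eq_of_aeval_eq_zero (h : ThreeTermRecurrence p a b) (hb : ∀ n, 0 < b n)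
    (hc : c ≠ 0) (hp : p 0 = C c) {n : ℕ} {z : ℂ} (hz : aeval z (p n) = 0) :
    (starRingEnd ℂ) z = z := by
  obtain _ | d := n
  · exact absurd hz (aeval_zero_ne_zero hc hp z)
  have aeval_conj_eq (q : ℝ[X]) : aeval (starRingEnd ℂ z) q = starRingEnd ℂ (aeval z q) :=
    aeval_conj q z
  have kernel := h.christoffel_darboux z (starRingEnd ℂ z) d
  simp only [aeval_conj_eq, hz, map_zero, mul_zero, zero_mul, sub_zero, Complex.mul_conj,
    Complex.coe_algebraMap] at kernel
  norm_cast at kernel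
  have kernel_ne_zero := Complex.ofReal_ne_zero.2 (sum_normSq_pos hb hc hp z d).ne'
  exact (sub_eq_zero.1 ((mul_eq_zero.1 kernel).resolve_right kernel_ne_zero)).symm

theorem splits (h : ThreeTermRecurrence p a b) (hb : ∀ n, 0 < b n) (hc : c ≠ 0)
    (hp : p 0 = C c) (n : ℕ) : (p n).Splits := by
  refine Splits.of_splits_map (algebraMap ℝ ℂ) (IsAlgClosed.splits _) fun z hz ↦ ?_
  have hz' : aeval z (p n) = 0 := by
    rw [aeval_def, ← eval_map]
    exact (isRoot_of_mem_roots hz)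
  obtain ⟨r, hr⟩ := Complex.conj_eq_iff_real.1 (h.conj_eq_of_aeval_eq_zero hb hc hp hz')
  exact ⟨r, hr.symm⟩

theorem nodup_roots (h : ThreeTermRecurrence p a b) (hb : ∀ n, 0 < b n) (hc : c ≠ 0)
    (hp : p 0 = C c) (n : ℕ) : (p n).roots.Nodup := by
  classical
  refine Multiset.nodup_iff_count_le_one.2 fun r ↦ ?_
  rw [count_roots]
  by_contra! double_root
  have sq_dvd : (X - C r) * (X - C r) ∣ p n :=
    (sq (X - C r)) ▸ (pow_dvd_pow _ double_root).trans (pow_rootMultiplicity_dvd _ _)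
  have eval_eq_zero : (p n).eval r = 0 := dvd_iff_isRoot.1 (dvd_of_mul_right_dvd sq_dvd)
  obtain _ | d := n
  · rw [hp, eval_C] at eval_eq_zero
    exact hc eval_eq_zero
  have kernel := h.christoffel_darboux X (C r) d
  have hC (q : ℝ[X]) : aeval (C r) q = C (q.eval r) := by
    rw [← algebraMap_eq, aeval_algebraMap_apply, coe_aeval_eq_eval]
  simp only [hC, eval_eq_zero, aeval_X_left_apply, map_zero, mul_zero, zero_sub] at kernel
  have dvd_sum : X - C r ∣ ∑ m ∈ Finset.range (d + 1),
      algebraMap ℝ ℝ[X] (∏ i ∈ Finset.range m, b i) * (p m * C ((p m).eval r)) := by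
    refine (mul_dvd_mul_iff_left (X_sub_C_ne_zero r)).1 (kernel ▸ ?_)
    exact ((sq_dvd.mul_right _).neg_right).mul_left _
  have sum_eq_zero := dvd_iff_isRoot.1 dvd_sum
  have aeval_eq (q : ℝ[X]) : aeval (r : ℂ) q = q.eval r := aeval_ofReal q r
  have sum_pos := sum_normSq_pos hb hc hp r d
  simp only [aeval_eq, Complex.normSq_ofReal] at sum_pos
  simp only [IsRoot.def, eval_finsetSum, eval_mul, algebraMap_eq, eval_C] at sum_eq_zero
  exact sum_pos.ne' sum_eq_zero

end ThreeTermRecurrence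

end OrthogonalPolynomials

section Laguerre

open Polynomial

theorem soninePoly_coeff (α n i : ℕ) : (soninePoly α n).coeff i =
    (-1) ^ i * n.choose i / ((n.factorial : ℝ) * (α + i).factorial) := by
  rw [soninePoly, laguerrePoly, coeff_C_mul, finsetSum_coeff]
  simp only [coeff_C_mul_X_pow, Finset.sum_ite_eq, Finset.mem_range, Nat.lt_succ_iff]
  split_ifs with h
  · rw [Nat.cast_choose ℝ (by lia : n - i ≤ n + α), show n + α - (n - i) = α + i by lia,
      Nat.cast_choose ℝ h]
    field
  · simp [Nat.choose_eq_zero_of_lt (not_le.1 h)]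

theorem soninePoly_natDegree (α n : ℕ) : (soninePoly α n).natDegree = n := by
  refine natDegree_eq_of_le_of_coeff_ne_zero (natDegree_le_iff_coeff_eq_zero.2 fun i hi ↦ ?_) ?_
  · simp [soninePoly_coeff, Nat.choose_eq_zero_of_lt hi]
  · rw [soninePoly_coeff, Nat.choose_self]
    positivity

theorem soninePoly_zero (α : ℕ) : soninePoly α 0 = C (1 / (α.factorial : ℝ)) := by
  simp [soninePoly, laguerrePoly]

theorem soninePoly_ne_zero (α n : ℕ) : soninePoly α n ≠ 0 := by
  obtain _ | n := n
  · simp [soninePoly_zero, Nat.factorial_ne_zero]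
  · exact ne_zero_of_natDegree_gt (n := n) (by rw [soninePoly_natDegree]; lia)

theorem soninePoly_eval_pos (α n : ℕ) {x : ℝ} (hx : x ≤ 0) : 0 < (soninePoly α n).eval x := by
  rw [eval_eq_sum_range, soninePoly_natDegree, Finset.sum_range_succ']
  refine add_pos_of_nonneg_of_pos (Finset.sum_nonneg fun i _ ↦ ?_) ?_
  · rw [soninePoly_coeff, div_mul_eq_mul_div, mul_right_comm, ← mul_pow, neg_one_mul]
    have := neg_nonneg.2 hx
    positivity
  · rw [soninePoly_coeff, Nat.choose_zero_right]
    positivity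

theorem soninePoly_one (α : ℕ) :
    C (1 + α : ℝ) * soninePoly α 1 = (C (1 + α : ℝ) - X) * soninePoly α 0 := by
  ext i
  rw [sub_mul, coeff_sub, coeff_C_mul, coeff_C_mul]
  obtain _ | _ | i := i
  · simp [soninePoly_coeff]
  · simp only [coeff_X_mul, soninePoly_coeff, zero_add, add_zero,
      Nat.factorial_succ]
    push_cast
    simp
    field
  · simp [coeff_X_mul, soninePoly_coeff, Nat.choose_eq_zero_of_lt]

theorem soninePoly_add_two (α n : ℕ) :
    C ((n + 2) * (n + 2 + α) : ℝ) * soninePoly α (n + 2) =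
      (C (2 * n + 3 + α : ℝ) - X) * soninePoly α (n + 1) - soninePoly α n := by
  ext i
  rw [sub_mul, coeff_sub, coeff_sub, coeff_C_mul, coeff_C_mul]
  obtain _ | i := i
  · simp only [coeff_X_mul_zero, soninePoly_coeff, Nat.choose_zero_right, Nat.factorial_succ]
    push_cast
    field
  · have absorb : ((n + 1 : ℕ) : ℝ) * n.choose i = (n + 1).choose (i + 1) * (i + 1 : ℕ) := by
      exact_mod_cast Nat.add_one_mul_choose_eq n i
    have absorb' :
        ((n + 2 : ℕ) : ℝ) * (n + 1).choose i = (n + 2).choose (i + 1) * (i + 1 : ℕ) := by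
      exact_mod_cast Nat.add_one_mul_choose_eq (n + 1) i
    have pascal : ((n + 1).choose (i + 1) : ℝ) = n.choose i + n.choose (i + 1) := by
      exact_mod_cast Nat.choose_succ_succ' n i
    have pascal' :
        ((n + 2).choose (i + 1) : ℝ) = (n + 1).choose i + (n + 1).choose (i + 1) := by
      exact_mod_cast Nat.choose_succ_succ' (n + 1) i
    simp only [coeff_X_mul, soninePoly_coeff, ← add_assoc, Nat.factorial_succ]
    push_cast at *
    field_simp
    linear_combination (-(-1) ^ i * (n + 2) : ℝ) *
      ((n + α + i + 3) * pascal' - (n + 1) * pascal + absorb' - absorb)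

theorem soninePoly_threeTermRecurrence (α : ℕ) : ThreeTermRecurrence (soninePoly α)
    (fun n ↦ 2 * n + 1 + α) (fun n ↦ (n + 1) * (n + 1 + α)) where
  zero := by simpa using soninePoly_one α
  succ n := by
    convert soninePoly_add_two α n using 3 <;> push_cast <;> ring_nf

theorem splits_soninePoly (α n : ℕ) : (soninePoly α n).Splits :=
  (soninePoly_threeTermRecurrence α).splits (fun _ ↦ by positivity) (by positivity)
    (soninePoly_zero α) n

theorem card_toFinset_roots_soninePoly (α n : ℕ) : (soninePoly α n).roots.toFinset.card = n := by
  rw [Multiset.toFinset_card_of_nodup, ← (splits_soninePoly α n).natDegree_eq_card_roots,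
    soninePoly_natDegree]
  exact (soninePoly_threeTermRecurrence α).nodup_roots (fun _ ↦ by positivity) (by positivity)
    (soninePoly_zero α) n

end Laguerre

section Laplacian

open MvPolynomial

variable {σ R : Type*} [Fintype σ] [CommRing R]

/-- The Laplace operator `∑ ∂²/∂X_i²` on polynomials. -/
noncomputable def polyLaplacian : MvPolynomial σ R →ₗ[R] MvPolynomial σ R :=
  ∑ i, (pderiv i).toLinearMap ∘ₗ (pderiv i).toLinearMap

/-- The product `∇f · ∇g` of the gradients of two polynomials. -/
noncomputable def gradInner (f g : MvPolynomial σ R) : MvPolynomial σ R :=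
  ∑ i, pderiv i f * pderiv i g

theorem polyLaplacian_apply (f : MvPolynomial σ R) :
    polyLaplacian f = ∑ i, pderiv i (pderiv i f) := by
  simp [polyLaplacian]

theorem gradInner_comm (f g : MvPolynomial σ R) : gradInner f g = gradInner g f := by
  simp only [gradInner, mul_comm]

theorem gradInner_mul_right (f g h : MvPolynomial σ R) :
    gradInner f (g * h) = g * gradInner f h + h * gradInner f g := by
  simp only [gradInner, Finset.mul_sum, ← Finset.sum_add_distrib]
  refine Finset.sum_congr rfl fun i _ ↦ ?_
  rw [Derivation.leibniz, smul_eq_mul, smul_eq_mul]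
  ring

theorem gradInner_pow_right (f g : MvPolynomial σ R) (n : ℕ) :
    gradInner f (g ^ n) = (n : MvPolynomial σ R) * g ^ (n - 1) * gradInner f g := by
  simp only [gradInner, Finset.mul_sum]
  refine Finset.sum_congr rfl fun i _ ↦ ?_
  rw [Derivation.leibniz_pow, nsmul_eq_mul, smul_eq_mul]
  ring

theorem polyLaplacian_mul (f g : MvPolynomial σ R) :
    polyLaplacian (f * g) = f * polyLaplacian g + 2 * gradInner f g + g * polyLaplacian f := by
  simp only [polyLaplacian_apply, gradInner, Finset.mul_sum, ← Finset.sum_add_distrib]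
  refine Finset.sum_congr rfl fun i _ ↦ ?_
  simp only [Derivation.leibniz, map_add, smul_eq_mul]
  ring

theorem polyLaplacian_pow (f : MvPolynomial σ R) (n : ℕ) :
    polyLaplacian (f ^ n) = (n : MvPolynomial σ R) * f ^ (n - 1) * polyLaplacian f
      + (n : MvPolynomial σ R) * (n - 1) * f ^ (n - 2) * gradInner f f := by
  induction n with
  | zero => simp [polyLaplacian_apply]
  | succ n ih =>
    rw [pow_succ, polyLaplacian_mul, ih, gradInner_comm, gradInner_pow_right]
    rcases n with _ | _ | n
    · simp
    · simp; ring
    · simp only [Nat.add_sub_cancel, Nat.cast_add, Nat.cast_one,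
        show n + 1 + 1 - 2 = n by omega, show n + 1 + 1 + 1 - 2 = n + 1 by omega]
      ring

theorem gradInner_eq_of_isHomogeneous {f g : MvPolynomial σ R} {q : ℕ} (hf : f.IsHomogeneous q)
    (hg : ∀ i, pderiv i g = X i) : gradInner f g = (q : MvPolynomial σ R) * f := by
  simp only [gradInner, hg]
  rw [← nsmul_eq_mul, ← hf.sum_X_mul_pderiv]
  simp only [mul_comm]

end Laplacian

section Colour

theorem two_smul_pow_three_of_trace_eq_zero {R : Type*} [CommRing R]
    {M : Matrix (Fin 3) (Fin 3) R} (hM : M.trace = 0) :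
    (2 : R) • M ^ 3 = (M ^ 2).trace • M + (2 * M.det) • 1 := by
  have h : M 2 2 = -M 0 0 - M 1 1 := by
    rw [Matrix.trace_fin_three] at hM
    linear_combination hM
  ext i j
  fin_cases i <;> fin_cases j <;>
    simp [pow_succ, Matrix.mul_apply, Fin.sum_univ_three, Matrix.trace_fin_three,
      Matrix.det_fin_three, h] <;> ring

variable {R : Type*} [CommRing R] [Algebra ℂ R]

theorem sum_generator_mul_generator (i j k l : Fin 3) :
    ∑ A, generator A i j * generator A k l =
      1 / 2 * ((if i = l ∧ j = k then 1 else 0) - if i = j ∧ k = l then 1 / 3 else 0) := by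
  have hI := Complex.I_sq
  have h3 : ((√3 : ℝ) : ℂ)⁻¹ ^ 2 = 1 / 3 := by
    rw [inv_pow, ← Complex.ofReal_pow, Real.sq_sqrt (by norm_num)]
    norm_num
  fin_cases i <;> fin_cases j <;> fin_cases k <;> fin_cases l <;>
    simp [generator, Fin.sum_univ_eight] <;> grind

theorem trace_generator_mul (A B : Fin 8) :
    (generator A * generator B).trace = if A = B then 1 / 2 else 0 := by
  have hI := Complex.I_sq
  have h3 : ((√3 : ℝ) : ℂ)⁻¹ ^ 2 = 1 / 3 := by
    rw [inv_pow, ← Complex.ofReal_pow, Real.sq_sqrt (by norm_num)]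
    norm_num
  fin_cases A <;> fin_cases B <;> simp [generator, Matrix.trace_fin_three] <;> grind

theorem trace_generator (A : Fin 8) : (generator A).trace = 0 := by
  fin_cases A <;> simp [generator, Matrix.trace_fin_three]
  ring

variable (R) in
/-- The generator `T^A` as a matrix over a complex algebra. -/
noncomputable def generatorIn (A : Fin 8) : Matrix (Fin 3) (Fin 3) R :=
  (generator A).map (algebraMap ℂ R)

theorem trace_generatorIn (A : Fin 8) : (generatorIn R A).trace = 0 := by
  have h := AddMonoidHom.map_trace (algebraMap ℂ R) (generator A)
  rw [trace_generator, map_zero] at h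
  exact h.symm

theorem sum_generatorIn_apply_mul (i j k l : Fin 3) (x : R) :
    ∑ A, generatorIn R A i j * x * generatorIn R A k l =
      (1 / 2 * ((if i = l ∧ j = k then 1 else 0) - if i = j ∧ k = l then 1 / 3 else 0) : ℂ) •
        x := by
  rw [← sum_generator_mul_generator, Algebra.smul_def, map_sum, Finset.sum_mul]
  refine Finset.sum_congr rfl fun A _ ↦ ?_
  rw [map_mul]
  simp only [generatorIn, Matrix.map_apply]
  ring

theorem sum_generatorIn_mul_mul (M : Matrix (Fin 3) (Fin 3) R) :
    ∑ A, generatorIn R A * M * generatorIn R A =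
      (1 / 2 : ℂ) • (M.trace • 1 - (1 / 3 : ℂ) • M) := by
  ext i j
  have h : (∑ A, generatorIn R A * M * generatorIn R A) i j =
      ∑ l, ∑ k, ∑ A, generatorIn R A i k * M k l * generatorIn R A l j := by
    simp only [Matrix.sum_apply, Matrix.mul_apply, Finset.sum_mul]
    rw [Finset.sum_comm]
    exact Finset.sum_congr rfl fun l _ ↦ Finset.sum_comm
  simp only [h, sum_generatorIn_apply_mul]
  by_cases hij : i = j <;>
    simp [mul_smul, sub_smul, ← Finset.smul_sum, Finset.sum_sub_distrib, ite_and, ite_smul,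
      Matrix.trace, hij]

theorem sum_trace_generatorIn_mul_smul (M : Matrix (Fin 3) (Fin 3) R) :
    ∑ A, (generatorIn R A * M).trace • generatorIn R A =
      (1 / 2 : ℂ) • (M - (1 / 3 : ℂ) • M.trace • 1) := by
  ext i j
  have h : (∑ A, (generatorIn R A * M).trace • generatorIn R A) i j =
      ∑ k, ∑ l, ∑ A, generatorIn R A k l * M l k * generatorIn R A i j := by
    simp only [Matrix.sum_apply, Matrix.smul_apply, Matrix.trace, Matrix.diag_apply,
      Matrix.mul_apply, Finset.sum_mul, smul_eq_mul]
    rw [Finset.sum_comm]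
    exact Finset.sum_congr rfl fun l _ ↦ Finset.sum_comm
  simp only [h, sum_generatorIn_apply_mul]
  by_cases hij : i = j <;>
    simp [mul_smul, sub_smul, ← Finset.smul_sum, Finset.sum_sub_distrib, ite_and, ite_smul,
      Matrix.trace, hij]

theorem sum_trace_generatorIn_mul_mul_trace (M N : Matrix (Fin 3) (Fin 3) R) :
    ∑ A, (generatorIn R A * M).trace * (generatorIn R A * N).trace =
      (1 / 2 : ℂ) • ((M * N).trace - (1 / 3 : ℂ) • (M.trace * N.trace)) := by
  have h := congrArg (fun K ↦ (K * N).trace) (sum_trace_generatorIn_mul_smul M)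
  simpa [Finset.sum_mul, Matrix.trace_sum, sub_mul] using h

end Colour

section Bricks

open MvPolynomial

theorem matrix_map_derivation_mul {S R : Type*} [CommSemiring S] [CommSemiring R] [Algebra S R]
    {n : Type*} [Fintype n] (D : Derivation S R R) (M N : Matrix n n R) :
    (M * N).map D = M.map D * N + M * N.map D := by
  ext i j
  simp [Matrix.mul_apply, Finset.sum_add_distrib, mul_comm, add_comm]

/-- The quadratic invariant `(a†a†)`. -/
noncomputable def quadInv : BosonFock := (brickMatrix ^ 2).trace

/-- The cubic invariant `(a†a†a†)`. -/
noncomputable def cubicInv : BosonFock := (brickMatrix ^ 3).trace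

/-- The coefficient of `f†_A` in the brick `(f†a†a†)`. -/
noncomputable def quadVec (A : Fin 8) : BosonFock :=
  (generatorIn BosonFock A * brickMatrix ^ 2).trace

theorem brickMatrix_eq_sum : brickMatrix = ∑ A, (X A : BosonFock) • generatorIn BosonFock A := by
  ext1 i j
  simp [brickMatrix, generatorIn, Matrix.sum_apply, mul_comm]

theorem trace_brickMatrix_sq : (brickMatrix ^ 2).trace = quadInv := rfl

theorem trace_brickMatrix : brickMatrix.trace = 0 := by
  simp [brickMatrix_eq_sum, Matrix.trace_sum, trace_generatorIn]

theorem trace_generatorIn_mul_generatorIn (A B : Fin 8) :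
    (generatorIn BosonFock A * generatorIn BosonFock B).trace = if A = B then C (1 / 2) else 0 := by
  rw [generatorIn, generatorIn, ← Matrix.map_mul, ← AddMonoidHom.map_trace, trace_generator_mul,
    apply_ite (algebraMap ℂ BosonFock), map_zero, algebraMap_eq]

theorem trace_generatorIn_mul_brickMatrix (A : Fin 8) :
    (generatorIn BosonFock A * brickMatrix).trace = (1 / 2 : ℂ) • (X A : BosonFock) := by
  simp [brickMatrix_eq_sum, Finset.mul_sum, Matrix.trace_sum, trace_generatorIn_mul_generatorIn,
    smul_eq_C_mul, mul_comm]

theorem pderiv_brickMatrix (A : Fin 8) :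
    brickMatrix.map (pderiv A) = generatorIn BosonFock A := by
  ext1 i j
  simp [brickMatrix, generatorIn, pderiv_X, Pi.single_apply]

theorem pderiv_generatorIn (A B : Fin 8) : (generatorIn BosonFock A).map (pderiv B) = 0 := by
  ext1 i j
  simp [generatorIn]

theorem pderiv_quadInv (A : Fin 8) : pderiv A quadInv = X A := by
  rw [quadInv, pow_two, AddMonoidHom.map_trace, matrix_map_derivation_mul, pderiv_brickMatrix,
    Matrix.trace_add, Matrix.trace_mul_comm brickMatrix, trace_generatorIn_mul_brickMatrix]
  algebra

theorem pderiv_cubicInv (A : Fin 8) : pderiv A cubicInv = 3 * quadVec A := by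
  rw [cubicInv, pow_three, AddMonoidHom.map_trace, matrix_map_derivation_mul,
    matrix_map_derivation_mul, pderiv_brickMatrix, quadVec, pow_two]
  simp only [mul_add, Matrix.trace_add]
  rw [Matrix.trace_mul_cycle' brickMatrix (generatorIn BosonFock A) brickMatrix,
    Matrix.trace_mul_cycle' brickMatrix brickMatrix (generatorIn BosonFock A)]
  ring

theorem pderiv_quadVec (A B : Fin 8) : pderiv B (quadVec A) =
    (generatorIn BosonFock B * (generatorIn BosonFock A * brickMatrix
      + brickMatrix * generatorIn BosonFock A)).trace := by
  rw [quadVec, pow_two, AddMonoidHom.map_trace, matrix_map_derivation_mul,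
    matrix_map_derivation_mul, pderiv_brickMatrix, pderiv_generatorIn, zero_mul, zero_add,
    mul_add, mul_add, Matrix.trace_add, Matrix.trace_add, add_comm,
    Matrix.trace_mul_cycle' (generatorIn BosonFock A) brickMatrix,
    Matrix.trace_mul_cycle' (generatorIn BosonFock A) (generatorIn BosonFock B),
    Matrix.trace_mul_cycle' brickMatrix]

theorem sum_generatorIn_mul_self :
    ∑ A, generatorIn BosonFock A * generatorIn BosonFock A = (4 / 3 : ℂ) • 1 := by
  have h := sum_generatorIn_mul_mul (1 : Matrix (Fin 3) (Fin 3) BosonFock)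
  simp only [mul_one, Matrix.trace_one, Fintype.card_fin, Nat.cast_smul_eq_nsmul] at h
  rw [h]
  module

theorem brickMatrix_pow_three :
    brickMatrix ^ 3 = (1 / 2 : ℂ) • quadInv • brickMatrix + brickMatrix.det • 1 := by
  have h := two_smul_pow_three_of_trace_eq_zero trace_brickMatrix
  rw [two_smul, trace_brickMatrix_sq, two_mul, add_smul] at h
  calc brickMatrix ^ 3 = (1 / 2 : ℂ) • (brickMatrix ^ 3 + brickMatrix ^ 3) := by module
    _ = (1 / 2 : ℂ) • quadInv • brickMatrix + brickMatrix.det • 1 := by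
      rw [h, smul_add, ← two_smul ℂ (brickMatrix.det • 1), smul_smul,
        one_div_mul_cancel two_ne_zero, one_smul]

theorem trace_generatorIn_mul_brickMatrix_pow_three (A : Fin 8) :
    (generatorIn BosonFock A * brickMatrix ^ 3).trace = (1 / 4 : ℂ) • (quadInv * X A) := by
  simp only [brickMatrix_pow_three, Matrix.mul_smul, mul_add, Matrix.trace_add, Matrix.trace_smul,
    mul_one, trace_generatorIn, smul_eq_mul, trace_generatorIn_mul_brickMatrix]
  algebra

theorem trace_brickMatrix_pow_four : (brickMatrix ^ 4).trace = (1 / 2 : ℂ) • quadInv ^ 2 := by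
  simp only [pow_succ' brickMatrix 3, brickMatrix_pow_three, Matrix.mul_smul, mul_add,
    Matrix.trace_add, Matrix.trace_smul, mul_one, trace_brickMatrix, smul_eq_mul, ← pow_two,
    trace_brickMatrix_sq]
  algebra

theorem polyLaplacian_X (A : Fin 8) : polyLaplacian (X A : BosonFock) = 0 := by
  simp [polyLaplacian_apply, pderiv_X, Pi.single_apply, apply_ite]

theorem polyLaplacian_quadInv : polyLaplacian quadInv = 8 := by
  simp [polyLaplacian_apply, pderiv_quadInv]

theorem polyLaplacian_quadVec (A : Fin 8) : polyLaplacian (quadVec A) = 0 := by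
  have h : ∀ B, pderiv B (pderiv B (quadVec A)) = 2 *
      (generatorIn BosonFock A * (generatorIn BosonFock B * generatorIn BosonFock B)).trace := by
    intro B
    rw [pderiv_quadVec, AddMonoidHom.map_trace]
    simp only [matrix_map_derivation_mul, pderiv_generatorIn, Matrix.map_add _ (map_add _),
      pderiv_brickMatrix, zero_mul, mul_zero, zero_add, add_zero, mul_add, Matrix.trace_add]
    rw [Matrix.trace_mul_cycle' (generatorIn BosonFock A),
      Matrix.trace_mul_cycle' (generatorIn BosonFock B) (generatorIn BosonFock A), two_mul]
  simp only [polyLaplacian_apply, h, ← Finset.mul_sum, ← Matrix.trace_sum,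
    sum_generatorIn_mul_self, Matrix.mul_smul, mul_one, Matrix.trace_smul, trace_generatorIn,
    smul_zero, mul_zero]

theorem polyLaplacian_cubicInv : polyLaplacian cubicInv = 0 := by
  have h : ∑ A, pderiv A (quadVec A) = 0 := by
    simp [pderiv_quadVec, mul_add, Matrix.trace_add, ← mul_assoc, Finset.sum_add_distrib,
      ← Matrix.trace_sum, ← Finset.sum_mul, sum_generatorIn_mul_self, sum_generatorIn_mul_mul,
      trace_brickMatrix]
  have h3 : ∀ A, pderiv A (3 * quadVec A) = 3 * pderiv A (quadVec A) := fun A ↦ by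
    simpa only [nsmul_eq_mul, Nat.cast_ofNat] using map_nsmul (pderiv A) 3 (quadVec A)
  simp only [polyLaplacian_apply, pderiv_cubicInv, h3, ← Finset.mul_sum, h, mul_zero]

theorem gradInner_cubicInv (f : BosonFock) :
    gradInner f cubicInv = 3 * ∑ A, pderiv A f * quadVec A := by
  simp only [gradInner, pderiv_cubicInv, Finset.mul_sum]
  exact Finset.sum_congr rfl fun A _ ↦ by ring

theorem gradInner_X_cubicInv (A : Fin 8) : gradInner (X A) cubicInv = 3 * quadVec A := by
  simp [gradInner_cubicInv, pderiv_X, Pi.single_apply]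

theorem gradInner_quadVec_cubicInv (A : Fin 8) :
    gradInner (quadVec A) cubicInv = (1 / 4 : ℂ) • (quadInv * X A) := by
  simp only [gradInner_cubicInv, pderiv_quadVec]
  have h : ((generatorIn BosonFock A * brickMatrix + brickMatrix * generatorIn BosonFock A)
      * brickMatrix ^ 2).trace = (1 / 2 : ℂ) • (quadInv * X A) := by
    rw [add_mul, Matrix.trace_add, mul_assoc, ← pow_succ', mul_assoc,
      Matrix.trace_mul_comm brickMatrix, mul_assoc, ← pow_succ,
      trace_generatorIn_mul_brickMatrix_pow_three]
    algebra
  have h' : (generatorIn BosonFock A * brickMatrix + brickMatrix * generatorIn BosonFock A).trace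
      = X A := by
    rw [Matrix.trace_add, Matrix.trace_mul_comm brickMatrix, trace_generatorIn_mul_brickMatrix]
    algebra
  simp only [quadVec, sum_trace_generatorIn_mul_mul_trace, h, h', trace_brickMatrix_sq]
  algebra

theorem gradInner_cubicInv_self :
    gradInner cubicInv cubicInv = (3 / 4 : ℂ) • quadInv ^ 2 := by
  simp only [gradInner_cubicInv, pderiv_cubicInv, mul_assoc, ← Finset.mul_sum]
  simp only [quadVec, sum_trace_generatorIn_mul_mul_trace, trace_brickMatrix_sq, ← pow_add,
    Nat.reduceAdd, trace_brickMatrix_pow_four]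
  algebra

end Bricks

section BrickStates

open MvPolynomial

theorem isHomogeneous_brickMatrix_pow (n : ℕ) (i j : Fin 3) :
    ((brickMatrix ^ n) i j).IsHomogeneous n := by
  induction n generalizing j with
  | zero =>
    rw [pow_zero, Matrix.one_apply]
    split_ifs
    exacts [isHomogeneous_one _ _, isHomogeneous_zero _ _ _]
  | succ n ih =>
    rw [pow_succ, Matrix.mul_apply]
    refine IsHomogeneous.sum _ _ _ fun k _ ↦ (ih k).mul ?_
    rw [brickMatrix, Matrix.of_apply]
    exact IsHomogeneous.sum _ _ _ fun A _ ↦ (isHomogeneous_X ℂ A).C_mul _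

theorem isHomogeneous_trace_brickMatrix_pow (n : ℕ) :
    (brickMatrix ^ n).trace.IsHomogeneous n :=
  IsHomogeneous.sum _ _ _ fun i _ ↦ isHomogeneous_brickMatrix_pow n i i

theorem isHomogeneous_trace_generatorIn_mul_brickMatrix_pow (A : Fin 8) (n : ℕ) :
    (generatorIn BosonFock A * brickMatrix ^ n).trace.IsHomogeneous n := by
  refine IsHomogeneous.sum _ _ _ fun i _ ↦ ?_
  rw [Matrix.diag, Matrix.mul_apply]
  exact IsHomogeneous.sum _ _ _ fun j _ ↦ (isHomogeneous_brickMatrix_pow n j i).C_mul _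

theorem isHomogeneous_quadInv : quadInv.IsHomogeneous 2 :=
  isHomogeneous_trace_brickMatrix_pow 2

theorem isHomogeneous_cubicInv : cubicInv.IsHomogeneous 3 :=
  isHomogeneous_trace_brickMatrix_pow 3

theorem isHomogeneous_quadVec (A : Fin 8) : (quadVec A).IsHomogeneous 2 :=
  isHomogeneous_trace_generatorIn_mul_brickMatrix_pow A 2

theorem isHomogeneous_brickState (b : FermionicBrick) (j k : ℕ) (A : Fin 8) :
    (brickState b j k A).IsHomogeneous (brickQuanta b j k) := by
  have h : brickQuanta b j k = b.bosons + 2 * j + 3 * k := by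
    rw [brickQuanta, add_comm, add_assoc]
  rw [h]
  exact ((isHomogeneous_trace_generatorIn_mul_brickMatrix_pow A b.bosons).mul
    (isHomogeneous_quadInv.pow j)).mul (isHomogeneous_cubicInv.pow k)

theorem gradInner_quadInv {f : BosonFock} {q : ℕ} (hf : f.IsHomogeneous q) :
    gradInner f quadInv = (q : BosonFock) * f :=
  gradInner_eq_of_isHomogeneous hf pderiv_quadInv

theorem polyLaplacian_quadInv_pow (j : ℕ) :
    polyLaplacian (quadInv ^ j) = (2 * j * (j + 3) : BosonFock) * quadInv ^ (j - 1) := by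
  rw [polyLaplacian_pow, polyLaplacian_quadInv,
    gradInner_quadInv isHomogeneous_quadInv]
  rcases j with _ | _ | j
  · simp
  · simp; ring
  · simp only [show j + 1 + 1 - 2 = j by omega, show j + 1 + 1 - 1 = j + 1 by omega]
    push_cast
    ring

theorem polyLaplacian_cubicInv_pow (k : ℕ) : polyLaplacian (cubicInv ^ k) =
    (3 / 4 * k * (k - 1) : ℂ) • (quadInv ^ 2 * cubicInv ^ (k - 2)) := by
  rw [polyLaplacian_pow, polyLaplacian_cubicInv, gradInner_cubicInv_self]
  generalize quadInv = u, cubicInv = v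
  algebra

theorem gradInner_quadInv_pow_cubicInv_pow (j k : ℕ) :
    gradInner (quadInv ^ j) (cubicInv ^ k) =
      (3 * j * k : BosonFock) * (quadInv ^ (j - 1) * cubicInv ^ k) := by
  rw [gradInner_pow_right, gradInner_comm, gradInner_pow_right,
    gradInner_quadInv isHomogeneous_cubicInv]
  rcases k with _ | k
  · simp
  · simp only [Nat.add_sub_cancel]
    push_cast
    ring

theorem polyLaplacian_quadInv_pow_mul_cubicInv_pow (j k : ℕ) :
    polyLaplacian (quadInv ^ j * cubicInv ^ k) =
      (2 * j * (j + 3 * k + 3) : ℂ) • (quadInv ^ (j - 1) * cubicInv ^ k)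
      + (3 / 4 * k * (k - 1) : ℂ) • (quadInv ^ (j + 2) * cubicInv ^ (k - 2)) := by
  rw [polyLaplacian_mul, polyLaplacian_quadInv_pow, polyLaplacian_cubicInv_pow,
    gradInner_quadInv_pow_cubicInv_pow]
  generalize quadInv = u, cubicInv = v
  algebra

theorem polyLaplacian_mul_quadInv_pow_mul_cubicInv_pow {f : BosonFock} {q : ℕ}
    (hf : f.IsHomogeneous q) (hf0 : polyLaplacian f = 0) (j k : ℕ) :
    polyLaplacian (f * (quadInv ^ j * cubicInv ^ k)) =
      (2 * j * (j + 3 * k + q + 3) : ℂ) • (f * (quadInv ^ (j - 1) * cubicInv ^ k))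
      + (2 * k : ℂ) • (gradInner f cubicInv * (quadInv ^ j * cubicInv ^ (k - 1)))
      + (3 / 4 * k * (k - 1) : ℂ) • (f * (quadInv ^ (j + 2) * cubicInv ^ (k - 2))) := by
  rw [polyLaplacian_mul, polyLaplacian_quadInv_pow_mul_cubicInv_pow, hf0, gradInner_mul_right,
    gradInner_pow_right, gradInner_pow_right, gradInner_quadInv hf]
  generalize quadInv = u, cubicInv = v
  algebra

theorem brickState_fa_apply (j k : ℕ) (A : Fin 8) :
    brickState .fa j k A = (1 / 2 : ℂ) • (X A * (quadInv ^ j * cubicInv ^ k)) := by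
  have h : (generatorIn BosonFock A * brickMatrix ^ 1).trace = (1 / 2 : ℂ) • (X A : BosonFock) := by
    rw [pow_one, trace_generatorIn_mul_brickMatrix]
  rw [← smul_mul_assoc, ← h, ← mul_assoc]
  rfl

theorem brickState_faa_apply (j k : ℕ) (A : Fin 8) :
    brickState .faa j k A = quadVec A * (quadInv ^ j * cubicInv ^ k) :=
  mul_assoc _ _ _

/-- The Laplacian `4 (aa)` on the one-fermion sector, acting on each component. -/
noncomputable def sectorLaplacian : Module.End ℂ OneFermionFock :=
  (polyLaplacian : BosonFock →ₗ[ℂ] BosonFock).compLeft (Fin 8)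

theorem sectorLaplacian_brickState_fa (j k : ℕ) :
    sectorLaplacian (brickState .fa j k) =
      (2 * j * (j + 3 * k + 4) : ℂ) • brickState .fa (j - 1) k
      + (3 * k : ℂ) • brickState .faa j (k - 1)
      + (3 / 4 * k * (k - 1) : ℂ) • brickState .fa (j + 2) (k - 2) := by
  ext1 A
  have h := polyLaplacian_mul_quadInv_pow_mul_cubicInv_pow (isHomogeneous_X ℂ A)
    (polyLaplacian_X A) j k
  simp only [sectorLaplacian, LinearMap.compLeft_apply, Function.comp_apply, Pi.add_apply,
    Pi.smul_apply, brickState_fa_apply, brickState_faa_apply, map_smul, h, gradInner_X_cubicInv]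
  generalize quadInv = u, cubicInv = v
  algebra

theorem sectorLaplacian_brickState_faa (j k : ℕ) :
    sectorLaplacian (brickState .faa j k) =
      (2 * j * (j + 3 * k + 5) : ℂ) • brickState .faa (j - 1) k
      + (k : ℂ) • brickState .fa (j + 1) (k - 1)
      + (3 / 4 * k * (k - 1) : ℂ) • brickState .faa (j + 2) (k - 2) := by
  ext1 A
  have h := polyLaplacian_mul_quadInv_pow_mul_cubicInv_pow
    (isHomogeneous_quadVec A) (polyLaplacian_quadVec A) j k
  simp only [sectorLaplacian, LinearMap.compLeft_apply, Function.comp_apply, Pi.add_apply,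
    Pi.smul_apply, brickState_fa_apply, brickState_faa_apply, h, gradInner_quadVec_cubicInv]
  generalize quadInv = u, cubicInv = v
  algebra

theorem trace_generator_sum_mul {S : Type*} [Ring S] [Algebra ℂ S] (f g : Fin 8 → S) :
    (((Matrix.of fun i j ↦ ∑ A, generator A i j • f A : Matrix (Fin 3) (Fin 3) S) *
      (Matrix.of fun i j ↦ ∑ A, generator A i j • g A : Matrix (Fin 3) (Fin 3) S))).trace =
      ∑ A, (1 / 2 : ℂ) • (f A * g A) := by
  calc _ = ∑ i, ∑ j, ∑ A, ∑ B, (generator A i j * generator B j i) • (f A * g B) := by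
        simp only [Matrix.trace, Matrix.diag, Matrix.mul_apply, Matrix.of_apply,
          Finset.sum_mul_sum, smul_mul_smul_comm]
    _ = ∑ A, ∑ B, ∑ i, ∑ j, (generator A i j * generator B j i) • (f A * g B) := by
        simp only [Finset.sum_comm (s := (Finset.univ : Finset (Fin 3)))
          (t := (Finset.univ : Finset (Fin 8)))]
    _ = ∑ A, ∑ B, (generator A * generator B).trace • (f A * g B) := by
        simp only [Matrix.trace, Matrix.diag, Matrix.mul_apply, Finset.sum_smul]
    _ = _ := by simp [trace_generator_mul]

theorem quadInv_eq_sum : quadInv = ∑ A, (1 / 2 : ℂ) • (X A * X A : BosonFock) := by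
  rw [← trace_generator_sum_mul, quadInv, pow_two]
  simp only [brickMatrix, smul_eq_C_mul]

/-- Multiplication by `(a†a†)` on the one-fermion sector. -/
noncomputable def quadCreation : Module.End ℂ OneFermionFock :=
  (LinearMap.mulLeft ℂ quadInv).compLeft (Fin 8)

theorem quadCreation_brickState (b : FermionicBrick) (j k : ℕ) :
    quadCreation (brickState b j k) = brickState b (j + 1) k := by
  ext1 A
  simp only [quadCreation, LinearMap.compLeft_apply, Function.comp_apply, LinearMap.mulLeft_apply,
    brickState, quadInv]
  ring

theorem trace_creationMatrix_sq : (creationMatrix * creationMatrix).trace = quadCreation := by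
  have h : (creationMatrix * creationMatrix).trace =
      ∑ A, (1 / 2 : ℂ) • (creationOp A * creationOp A) := trace_generator_sum_mul _ _
  refine LinearMap.ext fun ψ ↦ funext fun A ↦ ?_
  rw [h]
  simp [quadCreation, quadInv_eq_sum, creationOp, Finset.sum_mul, mul_assoc]

theorem trace_annihilationMatrix_sq :
    (annihilationMatrix * annihilationMatrix).trace = (1 / 2 : ℂ) • sectorLaplacian := by
  have h : (annihilationMatrix * annihilationMatrix).trace =
      ∑ A, (1 / 2 : ℂ) • (annihilationOp A * annihilationOp A) := trace_generator_sum_mul _ _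
  refine LinearMap.ext fun ψ ↦ funext fun A ↦ ?_
  rw [h]
  simp [sectorLaplacian, polyLaplacian_apply, annihilationOp, Finset.smul_sum]

theorem trace_creationMatrix_mul_annihilationMatrix {q : ℕ} {ψ : OneFermionFock}
    (hψ : ∀ A, (ψ A).IsHomogeneous q) :
    (creationMatrix * annihilationMatrix).trace ψ = (q / 2 : ℂ) • ψ := by
  have h : (creationMatrix * annihilationMatrix).trace =
      ∑ A, (1 / 2 : ℂ) • (creationOp A * annihilationOp A) := trace_generator_sum_mul _ _
  ext1 A
  have hE : ∑ B, X B * pderiv B (ψ A) = (q : ℂ) • ψ A := by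
    rw [(hψ A).sum_X_mul_pderiv, Nat.cast_smul_eq_nsmul]
  rw [h, ← Finset.smul_sum, LinearMap.smul_apply, LinearMap.sum_apply, Pi.smul_apply,
    Finset.sum_apply]
  refine (congrArg _ hE).trans ?_
  rw [Pi.smul_apply]
  module

theorem hamiltonian_apply_of_isHomogeneous {q : ℕ} {ψ : OneFermionFock}
    (hψ : ∀ A, (ψ A).IsHomogeneous q) :
    hamiltonian ψ = (q / 2 + 2 : ℂ) • ψ - (1 / 2 : ℂ) • quadCreation ψ
      - (1 / 4 : ℂ) • sectorLaplacian ψ := by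
  simp only [hamiltonian, trace_creationMatrix_sq, trace_annihilationMatrix_sq,
    LinearMap.sub_apply, LinearMap.add_apply, LinearMap.smul_apply, Module.End.one_apply,
    trace_creationMatrix_mul_annihilationMatrix hψ]
  module

theorem quantaCutoff_of_isHomogeneous (N : ℕ) {q : ℕ} {ψ : OneFermionFock}
    (hψ : ∀ A, (ψ A).IsHomogeneous q) : quantaCutoff N ψ = if q ≤ N then ψ else 0 := by
  ext1 A
  simp only [quantaCutoff, LinearMap.compLeft_apply, Function.comp_apply, LinearMap.sum_apply,
    homogeneousComponent_of_mem (hψ A), Finset.sum_ite_eq', Finset.mem_range, Nat.lt_succ_iff]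
  split_ifs <;> rfl

end BrickStates

section Independence

open MvPolynomial

section Evaluation

variable {S : Type*} [CommRing S] [Algebra ℂ S]

/-- Evaluation of states at a matrix `M`: it substitutes `2 tr (T^A M)` for `a†_A`, so that the
matrix `a†` becomes `M` whenever `M` is traceless. -/
noncomputable def evalAt (M : Matrix (Fin 3) (Fin 3) S) : BosonFock →ₐ[ℂ] S :=
  aeval fun A ↦ 2 * (generatorIn S A * M).trace

/-- Evaluation at `M` of the colour matrix `∑_A ψ_A T^A` of the one-fermion state `ψ`. -/
noncomputable def colourMatrixAt (M : Matrix (Fin 3) (Fin 3) S) :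
    OneFermionFock →ₗ[ℂ] Matrix (Fin 3) (Fin 3) S :=
  ∑ A, (LinearMap.toSpanSingleton S _ (generatorIn S A)).restrictScalars ℂ ∘ₗ
    (evalAt M).toLinearMap ∘ₗ LinearMap.proj A

theorem colourMatrixAt_apply (M : Matrix (Fin 3) (Fin 3) S) (ψ : OneFermionFock) :
    colourMatrixAt M ψ = ∑ A, evalAt M (ψ A) • generatorIn S A := by
  simp [colourMatrixAt]

variable {M : Matrix (Fin 3) (Fin 3) S}

theorem evalAt_mapMatrix_brickMatrix (hM : M.trace = 0) :
    (evalAt M).mapMatrix brickMatrix = M := by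
  have h := sum_trace_generatorIn_mul_smul M
  rw [hM, zero_smul, smul_zero, sub_zero] at h
  calc (evalAt M).mapMatrix brickMatrix
      = (2 : ℂ) • ∑ A, (generatorIn S A * M).trace • generatorIn S A := by
        ext i j
        simp only [AlgHom.mapMatrix_apply, Matrix.map_apply, brickMatrix, Matrix.of_apply,
          map_sum, map_mul, evalAt, aeval_X, algHom_C, generatorIn, Matrix.smul_apply,
          Matrix.sum_apply, smul_eq_mul, Finset.smul_sum]
        exact Finset.sum_congr rfl fun A _ ↦ by algebra
    _ = M := by
        rw [h]
        module

theorem evalAt_trace (N : Matrix (Fin 3) (Fin 3) BosonFock) :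
    evalAt M N.trace = ((evalAt M).mapMatrix N).trace :=
  AddMonoidHom.map_trace (evalAt M) N

theorem evalAt_mapMatrix_generatorIn (A : Fin 8) :
    (evalAt M).mapMatrix (generatorIn BosonFock A) = generatorIn S A := by
  ext i j
  simp [generatorIn]

theorem colourMatrixAt_brickState (hM : M.trace = 0) (b : FermionicBrick) (j k : ℕ) :
    colourMatrixAt M (brickState b j k) = ((M ^ 2).trace ^ j * (M ^ 3).trace ^ k) •
      (1 / 2 : ℂ) • (M ^ b.bosons - (1 / 3 : ℂ) • (M ^ b.bosons).trace • 1) := by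
  have h : ∀ A, evalAt M (brickState b j k A) = ((M ^ 2).trace ^ j * (M ^ 3).trace ^ k) *
      (generatorIn S A * M ^ b.bosons).trace := fun A ↦ by
    change evalAt M ((generatorIn BosonFock A * brickMatrix ^ b.bosons).trace * _ * _) = _
    simp only [map_mul, map_pow, evalAt_trace, evalAt_mapMatrix_generatorIn,
      evalAt_mapMatrix_brickMatrix hM]
    ring
  simp only [colourMatrixAt_apply, h, mul_smul _ (Matrix.trace _), ← Finset.smul_sum,
    sum_trace_generatorIn_mul_smul]

end Evaluation

/-- The companion matrix of a traceless `3 × 3` matrix whose invariants are independent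
variables. -/
noncomputable def tracelessCompanion : Matrix (Fin 3) (Fin 3) (MvPolynomial (Fin 2) ℂ) :=
  !![0, 1, 0; 0, 0, 1; X 1, X 0, 0]

theorem tracelessCompanion_sq :
    tracelessCompanion ^ 2 = !![0, 0, 1; X 1, X 0, 0; 0, X 1, X 0] := by
  simp [tracelessCompanion, pow_two]

theorem trace_tracelessCompanion : tracelessCompanion.trace = 0 := by
  simp [tracelessCompanion, Matrix.trace_fin_three]

theorem trace_tracelessCompanion_sq : (tracelessCompanion ^ 2).trace = 2 * X 0 := by
  simp [tracelessCompanion_sq, Matrix.trace_fin_three]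
  ring

theorem trace_tracelessCompanion_pow_three : (tracelessCompanion ^ 3).trace = 3 * X 1 := by
  simp [pow_succ tracelessCompanion 2, tracelessCompanion_sq, Matrix.trace_fin_three]
  simp [tracelessCompanion]
  ring

/-- The column of the first row of `tracelessCompanion ^ b.bosons` that contains the entry `1`. -/
def FermionicBrick.column : FermionicBrick → Fin 3
  | .fa => 1
  | .faa => 2

open Classical in
theorem tracelessCompanion_pow_bosons_apply (b b' : FermionicBrick) :
    (tracelessCompanion ^ b.bosons) 0 b'.column = if b = b' then 1 else 0 := by
  cases b with
  | fa => cases b' <;> simp [FermionicBrick.bosons, FermionicBrick.column, tracelessCompanion]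
  | faa => cases b' <;> simp [FermionicBrick.bosons, FermionicBrick.column, tracelessCompanion_sq]

open Classical in
theorem colourMatrixAt_tracelessCompanion_brickState (b b' : FermionicBrick) (j k : ℕ) :
    colourMatrixAt tracelessCompanion (brickState b j k) 0 b'.column =
      if b = b' then
        monomial (Finsupp.single 0 j + Finsupp.single 1 k) (2 ^ j * 3 ^ k / 2 : ℂ) else 0 := by
  have h : monomial (Finsupp.single 0 j + Finsupp.single 1 k) (2 ^ j * 3 ^ k / 2 : ℂ) =
      (1 / 2 : ℂ) • ((2 * X 0) ^ j * (3 * X 1) ^ k : MvPolynomial (Fin 2) ℂ) := by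
    rw [monomial_single_add, ← C_mul_X_pow_eq_monomial, ← smul_eq_C_mul]
    algebra
  have hb : (0 : Fin 3) ≠ b'.column := by cases b' <;> decide
  rw [colourMatrixAt_brickState trace_tracelessCompanion, trace_tracelessCompanion_sq,
    trace_tracelessCompanion_pow_three, h, smul_comm]
  simp [tracelessCompanion_pow_bosons_apply, hb]

/-- The functional dual to `brickState b j k`. -/
noncomputable def brickDual (s : FermionicBrick × ℕ × ℕ) : Module.Dual ℂ OneFermionFock :=
  (2 / (2 ^ s.2.1 * 3 ^ s.2.2) : ℂ) •
    lcoeff ℂ (Finsupp.single 0 s.2.1 + Finsupp.single 1 s.2.2) ∘ₗ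
      Matrix.entryLinearMap ℂ _ 0 s.1.column ∘ₗ colourMatrixAt tracelessCompanion

open Classical in
theorem brickDual_brickState (s t : FermionicBrick × ℕ × ℕ) :
    brickDual s (brickState t.1 t.2.1 t.2.2) = if s = t then 1 else 0 := by
  obtain ⟨b, j, k⟩ := s
  obtain ⟨b', j', k'⟩ := t
  have h : (Finsupp.single 0 j' + Finsupp.single 1 k' : Fin 2 →₀ ℕ) =
      Finsupp.single 0 j + Finsupp.single 1 k ↔ j = j' ∧ k = k' := by
    simp [Finsupp.ext_iff, Fin.forall_fin_two, eq_comm]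
  simp only [brickDual, LinearMap.smul_apply, LinearMap.comp_apply, Matrix.entryLinearMap_apply,
    colourMatrixAt_tracelessCompanion_brickState, lcoeff_apply, apply_ite (coeff _),
    coeff_monomial, coeff_zero, h, Prod.mk.injEq, eq_comm (a := b')]
  by_cases hs : b = b' ∧ j = j' ∧ k = k'
  · obtain ⟨rfl, rfl, rfl⟩ := hs
    simp [field]
  · rw [if_neg hs, ← ite_and, if_neg hs, smul_zero]

theorem brickState_linearIndependent :
    LinearIndependent ℂ fun s : FermionicBrick × ℕ × ℕ ↦ brickState s.1 s.2.1 s.2.2 :=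
  .of_pairwise_dual_eq_zero_one _ brickDual
    (fun s t hst ↦ (brickDual_brickState s t).trans (if_neg hst))
    fun s ↦ (brickDual_brickState s s).trans (if_pos rfl)

end Independence

section Chain

variable (P : QuantaParity)

theorem chainBrick_succ_eq_faa_iff (t : ℕ) :
    chainBrick P (t + 1) = .faa ↔ chainBrick P t = .fa := by
  cases P <;> by_cases h : Even t <;> simp [chainBrick, h, Nat.even_add_one]

theorem chainBrick_succ_eq_fa_iff (t : ℕ) :
    chainBrick P (t + 1) = .fa ↔ chainBrick P t = .faa := by
  cases P <;> by_cases h : Even t <;> simp [chainBrick, h, Nat.even_add_one]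

theorem chainBrick_add_two (t : ℕ) : chainBrick P (t + 2) = chainBrick P t := by
  cases P <;> simp [chainBrick, Nat.even_add]

theorem bosons_chainBrick_add_bosons_succ (t : ℕ) :
    (chainBrick P t).bosons + (chainBrick P (t + 1)).bosons = 3 := by
  rcases h : chainBrick P t with _ | _
  · rw [(chainBrick_succ_eq_faa_iff P t).2 h, FermionicBrick.bosons, FermionicBrick.bosons]
  · rw [(chainBrick_succ_eq_fa_iff P t).2 h, FermionicBrick.bosons, FermionicBrick.bosons]

theorem bosons_chainBrick_le_two (t : ℕ) : (chainBrick P t).bosons ≤ 2 := by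
  cases chainBrick P t <;> simp [FermionicBrick.bosons]

theorem chainIndex_succ (t : ℕ) :
    chainIndex P (t + 1) + 2 * (chainBrick P t).bosons = chainIndex P t + 6 := by
  have := bosons_chainBrick_add_bosons_succ P t
  simp only [chainIndex]
  omega

theorem chainIndex_strictMono : StrictMono (chainIndex P) :=
  strictMono_nat_of_lt_succ fun t ↦ by
    have := chainIndex_succ P t
    have := bosons_chainBrick_le_two P t
    omega

/-- The number of quadratic bricks by which a state with `y` cubic bricks exceeds a state with `m`
cubic bricks and the same number of quanta. -/
def chainShift (m y : ℕ) : ℕ := (chainIndex P m - chainIndex P y) / 2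

theorem chainIndex_eq_add_two_mul_chainShift {m y : ℕ} (h : y ≤ m) :
    chainIndex P m = chainIndex P y + 2 * chainShift P m y := by
  suffices 2 ∣ chainIndex P m - chainIndex P y by
    have := (chainIndex_strictMono P).monotone h
    rw [chainShift]
    omega
  induction m, h using Nat.le_induction with
  | base => simp
  | succ m hm ih =>
    have := chainIndex_succ P m
    have := (chainIndex_strictMono P).monotone hm
    omega

theorem chainShift_self (m : ℕ) : chainShift P m m = 0 := by
  simp [chainShift]

theorem chainShift_succ_self (y : ℕ) : chainShift P (y + 1) y = 3 - (chainBrick P y).bosons := by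
  have := chainIndex_succ P y
  rw [chainShift]
  omega

theorem chainShift_add_chainShift {m x y : ℕ} (hyx : y ≤ x) (hxm : x ≤ m) :
    chainShift P m x + chainShift P x y = chainShift P m y := by
  have := chainIndex_eq_add_two_mul_chainShift P hyx
  have := chainIndex_eq_add_two_mul_chainShift P hxm
  have := chainIndex_eq_add_two_mul_chainShift P (hyx.trans hxm)
  omega

theorem chainShift_add_two_self (y : ℕ) : chainShift P (y + 2) y = 3 := by
  simp only [chainShift, chainIndex, chainBrick_add_two]
  omega

/-- The basis state with `y` cubic bricks, `j` quadratic bricks and the fermionic brick that the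
parity `P` dictates. -/
noncomputable def chainBasis (y j : ℕ) : OneFermionFock := brickState (chainBrick P y) j y

/-- The part of `sectorLaplacian (chainBasis P y j)` with one cubic brick removed. -/
noncomputable def removeOneCubic : ℕ → ℕ → OneFermionFock
  | 0, _ => 0
  | y + 1, j => (-2 * chainChi P y : ℂ) • chainBasis P y (j + chainShift P (y + 1) y - 1)

/-- The part of `sectorLaplacian (chainBasis P y j)` with two cubic bricks removed. -/
noncomputable def removeTwoCubic : ℕ → ℕ → OneFermionFock
  | 0, _ => 0
  | 1, _ => 0
  | y + 2, j => (-2 * chainMu y : ℂ) • chainBasis P y (j + 2)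

variable {P} in
theorem removeOneCubic_of_fa {y : ℕ} (h : chainBrick P y = .fa) (j : ℕ) :
    removeOneCubic P y j = (3 * y : ℂ) • brickState .faa j (y - 1) := by
  rcases y with _ | y
  · simp [removeOneCubic]
  · rw [chainBrick_succ_eq_fa_iff] at h
    simp only [removeOneCubic, chainBasis, chainChi, chainShift_succ_self, h,
      FermionicBrick.bosons, Nat.add_sub_cancel]
    push_cast
    ring_nf

variable {P} in
theorem removeOneCubic_of_faa {y : ℕ} (h : chainBrick P y = .faa) (j : ℕ) :
    removeOneCubic P y j = (y : ℂ) • brickState .fa (j + 1) (y - 1) := by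
  rcases y with _ | y
  · simp [removeOneCubic]
  · rw [chainBrick_succ_eq_faa_iff] at h
    simp only [removeOneCubic, chainBasis, chainChi, chainShift_succ_self, h,
      FermionicBrick.bosons, Nat.add_sub_cancel]
    push_cast
    ring_nf

theorem removeTwoCubic_eq (y j : ℕ) :
    removeTwoCubic P y j =
      (3 / 4 * y * (y - 1) : ℂ) • brickState (chainBrick P y) (j + 2) (y - 2) := by
  rcases y with _ | _ | y
  · simp [removeTwoCubic]
  · simp [removeTwoCubic]
  · simp only [removeTwoCubic, chainBasis, chainBrick_add_two, chainMu]
    push_cast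
    ring_nf

theorem sectorLaplacian_chainBasis (y j : ℕ) :
    sectorLaplacian (chainBasis P y j) =
      (2 * j * (j + chainIndex P y) : ℂ) • chainBasis P y (j - 1)
        + removeOneCubic P y j + removeTwoCubic P y j := by
  rw [removeTwoCubic_eq]
  rcases hb : chainBrick P y with _ | _
  · rw [removeOneCubic_of_fa hb, chainBasis, chainBasis, hb, sectorLaplacian_brickState_fa,
      chainIndex, hb, FermionicBrick.bosons]
    push_cast
    ring_nf
  · rw [removeOneCubic_of_faa hb, chainBasis, chainBasis, hb, sectorLaplacian_brickState_faa,
      chainIndex, hb, FermionicBrick.bosons]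
    push_cast
    ring_nf

theorem mixing_self (m : ℕ) : mixing P m m = 1 := by
  rw [mixing]
  simp

theorem mixing_of_lt {m y : ℕ} (h : m < y) : mixing P m y = 0 := by
  rw [mixing, if_pos h]

theorem mixing_recurrence {m y : ℕ} (h : y ≤ m) :
    mixing P m y * ((chainIndex P m : ℝ) ^ 2 - (chainIndex P y : ℝ) ^ 2) =
      4 * (chainChi P y * mixing P m (y + 1) + chainMu y * mixing P m (y + 2)) := by
  rcases h.eq_or_lt with rfl | h
  · rw [mixing_of_lt P y.lt_succ_self, mixing_of_lt P (by lia : y < y + 2)]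
    ring
  · have hlt : (chainIndex P y : ℝ) < chainIndex P m := by exact_mod_cast chainIndex_strictMono P h
    have hsq : (chainIndex P m : ℝ) ^ 2 - (chainIndex P y : ℝ) ^ 2 ≠ 0 :=
      (sub_pos.2 (pow_lt_pow_left₀ hlt (Nat.cast_nonneg _) two_ne_zero)).ne'
    rw [mixing, if_neg h.not_gt, if_neg h.ne, div_mul_cancel₀ _ hsq]

/-- The state with `m` cubic bricks at most, dressed with states of fewer cubic bricks so that
`sectorLaplacian` maps it to a multiple of the state with one quadratic brick less. -/
noncomputable def chainState (m n : ℕ) : OneFermionFock :=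
  ∑ y ∈ Finset.range (m + 1), (mixing P m y : ℂ) • chainBasis P y (n + chainShift P m y)

theorem sum_mixing_smul_removeOneCubic (m n : ℕ) :
    ∑ y ∈ Finset.range (m + 1), (mixing P m y : ℂ) • removeOneCubic P y (n + chainShift P m y) =
      ∑ y ∈ Finset.range (m + 1), (-2 * chainChi P y * mixing P m (y + 1) : ℂ) •
        chainBasis P y (n + chainShift P m y - 1) := by
  rw [Finset.sum_range_succ', Finset.sum_range_succ, mixing_of_lt P m.lt_succ_self]
  simp only [removeOneCubic, smul_zero, add_zero, Complex.ofReal_zero, mul_zero, zero_smul]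
  refine Finset.sum_congr rfl fun y hy ↦ ?_
  rw [smul_smul, mul_comm, add_assoc,
    chainShift_add_chainShift P y.le_succ (Nat.succ_le_of_lt (Finset.mem_range.1 hy))]

theorem sum_mixing_smul_removeTwoCubic (m n : ℕ) :
    ∑ y ∈ Finset.range (m + 1), (mixing P m y : ℂ) • removeTwoCubic P y (n + chainShift P m y) =
      ∑ y ∈ Finset.range (m + 1), (-2 * chainMu y * mixing P m (y + 2) : ℂ) •
        chainBasis P y (n + chainShift P m y - 1) := by
  rcases m with _ | m
  · simp [removeTwoCubic, mixing_of_lt]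
  rw [Finset.sum_range_succ', Finset.sum_range_succ', Finset.sum_range_succ,
    Finset.sum_range_succ, mixing_of_lt P (by lia : m + 1 < m + 2),
    mixing_of_lt P (by lia : m + 1 < m + 1 + 2)]
  simp only [removeTwoCubic, smul_zero, add_zero, zero_add, Complex.ofReal_zero, mul_zero,
    zero_smul]
  refine Finset.sum_congr rfl fun y hy ↦ ?_
  have hy' : y + 2 ≤ m + 1 := by have := Finset.mem_range.1 hy; lia
  rw [smul_smul, mul_comm, ← chainShift_add_chainShift P (y.le_add_right 2) hy',
    chainShift_add_two_self]
  rfl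

theorem mixing_laplacian_identity {m y : ℕ} (h : y ≤ m) (n : ℕ) :
    (mixing P m y * (2 * ↑(n + chainShift P m y) * (↑(n + chainShift P m y) + chainIndex P y))
        + -2 * chainChi P y * mixing P m (y + 1) + -2 * chainMu y * mixing P m (y + 2) : ℂ) =
      2 * n * (n + chainIndex P m) * mixing P m y := by
  have hrec := mixing_recurrence P h
  rw [chainIndex_eq_add_two_mul_chainShift P h] at hrec ⊢
  have hrec' := congrArg (fun x : ℝ ↦ (x : ℂ)) hrec
  push_cast at hrec' ⊢
  linear_combination (1 / 2 : ℂ) * hrec'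

theorem sectorLaplacian_chainState (m n : ℕ) :
    sectorLaplacian (chainState P m n) =
      (2 * n * (n + chainIndex P m) : ℂ) • chainState P m (n - 1) := by
  simp only [chainState, map_sum, map_smul, sectorLaplacian_chainBasis, smul_add,
    Finset.sum_add_distrib, sum_mixing_smul_removeOneCubic, sum_mixing_smul_removeTwoCubic]
  simp only [← Finset.sum_add_distrib, smul_smul, ← add_smul, Finset.smul_sum]
  refine Finset.sum_congr rfl fun y hy ↦ ?_
  rw [mixing_laplacian_identity P (Finset.mem_range_succ_iff.1 hy)]
  rcases n with _ | n
  · simp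
  · rw [Nat.add_sub_cancel, Nat.add_right_comm, Nat.add_sub_cancel]

/-- The number of bosonic quanta of `chainState P m n`. -/
def chainQuanta (m n : ℕ) : ℕ := brickQuanta (chainBrick P m) n m

theorem chainQuanta_add_chainShift {m y : ℕ} (h : y ≤ m) (n : ℕ) :
    chainQuanta P y (n + chainShift P m y) = chainQuanta P m n := by
  have := chainIndex_eq_add_two_mul_chainShift P h
  simp only [chainIndex] at this
  simp only [chainQuanta, brickQuanta]
  omega

theorem isHomogeneous_chainState (m n : ℕ) (A : Fin 8) :
    (chainState P m n A).IsHomogeneous (chainQuanta P m n) := by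
  rw [chainState, Finset.sum_apply]
  refine MvPolynomial.IsHomogeneous.sum _ _ _ fun y hy ↦ ?_
  rw [Pi.smul_apply, MvPolynomial.smul_eq_C_mul,
    ← chainQuanta_add_chainShift P (Finset.mem_range_succ_iff.1 hy) n]
  exact (isHomogeneous_brickState _ _ _ _).C_mul _

theorem quadCreation_chainState (m n : ℕ) :
    quadCreation (chainState P m n) = chainState P m (n + 1) := by
  simp only [chainState, map_sum, map_smul, chainBasis, quadCreation_brickState,
    Nat.add_right_comm n _ 1]

theorem hamiltonian_chainState (m n : ℕ) :
    hamiltonian (chainState P m n) =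
      (n + (chainIndex P m + 1) / 2 : ℂ) • chainState P m n
        - (1 / 2 : ℂ) • chainState P m (n + 1)
        - (1 / 2 * n * (n + chainIndex P m) : ℂ) • chainState P m (n - 1) := by
  rw [hamiltonian_apply_of_isHomogeneous (isHomogeneous_chainState P m n),
    quadCreation_chainState, sectorLaplacian_chainState, smul_smul, chainQuanta, brickQuanta,
    chainIndex]
  push_cast
  ring_nf

theorem quantaCutoff_chainState (N m n : ℕ) :
    quantaCutoff N (chainState P m n) =
      if chainQuanta P m n ≤ N then chainState P m n else 0 :=
  quantaCutoff_of_isHomogeneous N (isHomogeneous_chainState P m n)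

end Chain

section DressedBasis

/-- The labels `(b, j, k)` of the basis states `brickState b j k`. -/
abbrev BrickLabel : Type := FermionicBrick × ℕ × ℕ

namespace BrickLabel

/-- The basis state with a given label. -/
noncomputable def basis (s : BrickLabel) : OneFermionFock := brickState s.1 s.2.1 s.2.2

/-- The number of bosonic quanta of the basis state with a given label. -/
def quanta (s : BrickLabel) : ℕ := brickQuanta s.1 s.2.1 s.2.2

/-- The parity of `quanta s`. -/
def parity (s : BrickLabel) : QuantaParity :=
  match s.1 with
  | .fa => if Even s.2.2 then .odd else .even
  | .faa => if Even s.2.2 then .even else .odd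

/-- The chain state whose leading term is the basis state with a given label. -/
noncomputable def dressed (s : BrickLabel) : OneFermionFock := chainState s.parity s.2.2 s.2.1

theorem chainBrick_parity (s : BrickLabel) : chainBrick s.parity s.2.2 = s.1 := by
  obtain ⟨b, j, k⟩ := s
  cases b <;> by_cases h : Even k <;> simp [chainBrick, parity, h]

theorem parity_chainBrick (P : QuantaParity) (n m : ℕ) :
    parity (chainBrick P m, n, m) = P := by
  cases P <;> by_cases h : Even m <;> simp [chainBrick, parity, h]

theorem dressed_chainBrick (P : QuantaParity) (n m : ℕ) :
    dressed (chainBrick P m, n, m) = chainState P m n := by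
  rw [dressed, parity_chainBrick]

theorem chainQuanta_parity (s : BrickLabel) : chainQuanta s.parity s.2.2 s.2.1 = s.quanta := by
  rw [chainQuanta, chainBrick_parity, quanta]

theorem parity_eq_iff (P : QuantaParity) (s : BrickLabel) :
    s.parity = P ↔ match P with
      | .odd => Odd s.quanta
      | .even => Even s.quanta := by
  obtain ⟨b, j, k⟩ := s
  by_cases hk : Even k <;> cases P <;> cases b <;>
    simp [parity, quanta, brickQuanta, FermionicBrick.bosons, hk, parity_simps]

theorem dressed_sub_basis_mem_span (s : BrickLabel) :
    s.dressed - s.basis ∈ Submodule.span ℂ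
      (basis '' {t | t.parity = s.parity ∧ t.quanta = s.quanta ∧ t.2.2 < s.2.2}) := by
  rw [dressed, chainState, Finset.sum_range_succ, mixing_self, chainShift_self, chainBasis,
    chainBrick_parity, Complex.ofReal_one, one_smul, add_zero, basis, add_sub_cancel_right]
  refine Submodule.sum_mem _ fun y hy ↦ Submodule.smul_mem _ _ (Submodule.subset_span ?_)
  have hlt := Finset.mem_range.1 hy
  refine ⟨(chainBrick s.parity y, _, y), ⟨parity_chainBrick _ _ _, ?_, hlt⟩, rfl⟩
  rw [← chainQuanta_parity s, ← chainQuanta_add_chainShift s.parity hlt.le]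
  rfl

theorem basis_linearIndependent : LinearIndependent ℂ basis := brickState_linearIndependent

theorem dressed_linearIndependent : LinearIndependent ℂ dressed :=
  linearIndependent_of_sub_mem_span_lt (fun s ↦ s.2.2) basis_linearIndependent fun s ↦
    Submodule.span_mono (Set.image_mono fun _ ht ↦ ht.2.2) (dressed_sub_basis_mem_span s)

theorem span_image_dressed {S : Set BrickLabel}
    (hS : ∀ s ∈ S, ∀ t : BrickLabel, t.parity = s.parity → t.quanta = s.quanta →
      t.2.2 < s.2.2 → t ∈ S) :
    Submodule.span ℂ (dressed '' S) = Submodule.span ℂ (basis '' S) :=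
  span_image_eq_of_sub_mem_span_lt (fun s ↦ s.2.2) fun s hs ↦
    Submodule.span_mono
      (Set.image_mono fun t ht ↦ And.intro (hS s hs t ht.1 ht.2.1 ht.2.2) ht.2.2)
      (dressed_sub_basis_mem_span s)

end BrickLabel

theorem cutSpace_eq_span_image_dressed (N : ℕ) :
    cutSpace N = Submodule.span ℂ (BrickLabel.dressed '' {s | s.quanta ≤ N}) := by
  rw [BrickLabel.span_image_dressed (S := {s | s.quanta ≤ N}) fun s hs t _ ht _ ↦ ht.trans_le hs,
    cutSpace]
  congr 1
  ext ψ
  simp only [Set.mem_image, Prod.exists]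
  exact exists₃_congr fun b j k ↦ and_congr_right' eq_comm

end DressedBasis

section ChainVector

variable (P : QuantaParity)

/-- The number of states `chainState P m n` with at most `N` quanta. -/
def chainCount (N : ℕ) (m : ℕ) : ℕ := (N + 2 - (3 * m + (chainBrick P m).bosons)) / 2

theorem lt_chainCount_iff {N m n : ℕ} : n < chainCount P N m ↔ chainQuanta P m n ≤ N := by
  have := bosons_chainBrick_le_two P m
  rw [chainCount, chainQuanta, brickQuanta]
  omega

/-- The combination of the first `d` states of a chain whose coefficients are the values at `2z` of
the polynomials `L_n` of the chain. -/
noncomputable def chainVector (m d : ℕ) (z : ℂ) : OneFermionFock :=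
  ∑ n ∈ Finset.range d,
    Polynomial.aeval (2 * z) (soninePoly (chainIndex P m) n) • chainState P m n

variable {P}

theorem pos_of_aeval_soninePoly_eq_zero {α n : ℕ} {z : ℂ}
    (hz : Polynomial.aeval z (soninePoly α n) = 0) : 0 < n := by
  rw [Nat.pos_iff_ne_zero]
  rintro rfl
  simp [soninePoly_zero, Nat.factorial_ne_zero] at hz

theorem aeval_soninePoly_one (α : ℕ) (z : ℂ) :
    (1 + α) * Polynomial.aeval z (soninePoly α 1) =
      (1 + α - z) * Polynomial.aeval z (soninePoly α 0) := by
  simpa using congrArg (Polynomial.aeval z) (soninePoly_one α)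

theorem aeval_soninePoly_add_two (α n : ℕ) (z : ℂ) :
    (n + 2) * (n + 2 + α) * Polynomial.aeval z (soninePoly α (n + 2)) =
      (2 * n + 3 + α - z) * Polynomial.aeval z (soninePoly α (n + 1)) -
        Polynomial.aeval z (soninePoly α n) := by
  simpa using congrArg (Polynomial.aeval z) (soninePoly_add_two α n)

theorem hamiltonian_chainVector_succ (m d : ℕ) (z : ℂ) :
    hamiltonian (chainVector P m (d + 1) z) = z • chainVector P m (d + 1) z
      - (1 / 2 * Polynomial.aeval (2 * z) (soninePoly (chainIndex P m) d)) •
        chainState P m (d + 1)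
      + (1 / 2 * ((d + 1) * (d + 1 + chainIndex P m)) *
          Polynomial.aeval (2 * z) (soninePoly (chainIndex P m) (d + 1))) • chainState P m d := by
  induction d with
  | zero =>
    have hrec := aeval_soninePoly_one (chainIndex P m) (2 * z)
    rw [chainVector, Finset.sum_range_one, map_smul, hamiltonian_chainState]
    match_scalars
    · linear_combination (-1 / 2) * hrec
    · ring
  | succ d ih =>
    have hrec := aeval_soninePoly_add_two (chainIndex P m) d (2 * z)
    rw [chainVector, Finset.sum_range_succ, ← chainVector, map_add, map_smul, ih,
      hamiltonian_chainState, Nat.add_sub_cancel]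
    push_cast
    match_scalars
    · ring
    · linear_combination (-1 / 2) * hrec
    · ring
    · ring

theorem quantaCutoff_chainVector (N m : ℕ) (z : ℂ) :
    quantaCutoff N (chainVector P m (chainCount P N m) z) =
      chainVector P m (chainCount P N m) z := by
  rw [chainVector, map_sum]
  refine Finset.sum_congr rfl fun n hn ↦ ?_
  rw [map_smul, quantaCutoff_chainState,
    if_pos ((lt_chainCount_iff P).1 (Finset.mem_range.1 hn))]

theorem quantaCutoff_hamiltonian_chainVector {N m : ℕ} {z : ℂ}
    (hz : Polynomial.aeval (2 * z) (soninePoly (chainIndex P m) (chainCount P N m)) = 0) :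
    quantaCutoff N (hamiltonian (chainVector P m (chainCount P N m) z)) =
      z • chainVector P m (chainCount P N m) z := by
  have hcut := quantaCutoff_chainVector (P := P) N m z
  have hlast : ¬ chainQuanta P m (chainCount P N m) ≤ N :=
    fun h ↦ ((lt_chainCount_iff P).2 h).false
  obtain ⟨d, hd⟩ := Nat.exists_eq_add_one.2 (pos_of_aeval_soninePoly_eq_zero hz)
  rw [hd] at hz hcut hlast ⊢
  rw [hamiltonian_chainVector_succ, hz, mul_zero, zero_smul, add_zero, map_sub, map_smul,
    map_smul, hcut, quantaCutoff_chainState, if_neg hlast, smul_zero, sub_zero]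

theorem chainVector_mem_cutSpace (N m : ℕ) (z : ℂ) :
    chainVector P m (chainCount P N m) z ∈ cutSpace N := by
  rw [cutSpace_eq_span_image_dressed]
  refine Submodule.sum_mem _ fun n hn ↦ Submodule.smul_mem _ _ (Submodule.subset_span ?_)
  refine ⟨(chainBrick P m, n, m), ?_, BrickLabel.dressed_chainBrick P n m⟩
  exact (lt_chainCount_iff P).1 (Finset.mem_range.1 hn)

theorem chainState_linearIndependent (m : ℕ) : LinearIndependent ℂ (chainState P m) := by
  have hinj : Function.Injective fun n : ℕ ↦ ((chainBrick P m, n, m) : BrickLabel) :=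
    fun n n' h ↦ (Prod.ext_iff.1 (Prod.ext_iff.1 h).2).1
  simpa only [Function.comp_def, BrickLabel.dressed_chainBrick] using
    BrickLabel.dressed_linearIndependent.comp _ hinj

theorem chainVector_ne_zero {m d : ℕ} (hd : 0 < d) (z : ℂ) : chainVector P m d z ≠ 0 := by
  intro h
  have h0 := linearIndependent_iff'.1 (chainState_linearIndependent m) _ _ h 0
    (Finset.mem_range.2 hd)
  exact (pos_of_aeval_soninePoly_eq_zero h0).false

end ChainVector

section ChainBasis

variable (P : QuantaParity)

theorem chainState_eq_chainBasis_add (m n : ℕ) :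
    chainState P m n = chainBasis P m n + ∑ y ∈ Finset.range m,
      (mixing P m y : ℂ) • chainBasis P y (n + chainShift P m y) := by
  rw [chainState, Finset.sum_range_succ, mixing_self, Complex.ofReal_one, one_smul,
    chainShift_self, add_zero, add_comm]

variable {P}

theorem brickState_eq_chainBasis {b : FermionicBrick} {j y m n : ℕ} (hy : y ≤ m)
    (h : brickQuanta b j y = chainQuanta P m n) :
    brickState b j y = chainBasis P y (n + chainShift P m y) := by
  rw [← chainQuanta_add_chainShift P hy, chainQuanta] at h
  have hb : b = chainBrick P y := by
    cases b <;> cases hP : chainBrick P y <;>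
      simp only [hP, brickQuanta, FermionicBrick.bosons, reduceCtorEq] at h ⊢ <;> omega
  rw [chainBasis, hb]
  rw [hb, brickQuanta, brickQuanta] at h
  rw [show j = n + chainShift P m y by omega]

end ChainBasis

namespace FamilyType

theorem chainBrick_eq (F : FamilyType) (κ : ℕ) :
    chainBrick F.parity (F.maxCubic κ) = F.leadingBrick := by
  cases F <;> simp [chainBrick, parity, maxCubic, leadingBrick]

theorem upperIndex_eq (F : FamilyType) (κ : ℕ) :
    F.upperIndex κ = 3 * F.maxCubic κ + 3 + F.leadingBrick.bosons := by
  cases F <;> simp only [upperIndex, maxCubic, leadingBrick, FermionicBrick.bosons] <;> ring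

theorem chainIndex_eq (F : FamilyType) (κ : ℕ) :
    chainIndex F.parity (F.maxCubic κ) = F.upperIndex κ := by
  rw [chainIndex, chainBrick_eq, upperIndex_eq]

theorem solutionCount_eq (N : ℕ) (F : FamilyType) (κ : ℕ) :
    F.solutionCount N κ = (N + 2 - (3 * F.maxCubic κ + F.leadingBrick.bosons)) / 2 := by
  cases F <;> simp only [solutionCount, maxCubic, leadingBrick, FermionicBrick.bosons] <;> omega

theorem chainCount_eq (N : ℕ) (F : FamilyType) (κ : ℕ) :
    chainCount F.parity N (F.maxCubic κ) = F.solutionCount N κ := by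
  rw [chainCount, chainBrick_eq, solutionCount_eq]

theorem chainQuanta_eq (F : FamilyType) (κ n : ℕ) :
    chainQuanta F.parity (F.maxCubic κ) n = brickQuanta F.leadingBrick n (F.maxCubic κ) := by
  rw [chainQuanta, chainBrick_eq]

theorem dressedState_eq (F : FamilyType) (κ n : ℕ) :
    F.dressedState κ n = chainState F.parity (F.maxCubic κ) n := by
  obtain ⟨f, hf⟩ : ∃ f : ℕ → OneFermionFock, ∀ y, f y = (mixing F.parity (F.maxCubic κ) y : ℂ) •
    chainBasis F.parity y (n + chainShift F.parity (F.maxCubic κ) y) := ⟨_, fun _ ↦ rfl⟩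
  have hterm (b : FermionicBrick) (j y : ℕ) (hy : y ≤ F.maxCubic κ)
      (h : brickQuanta b j y = brickQuanta F.leadingBrick n (F.maxCubic κ)) :
      (mixing F.parity (F.maxCubic κ) y : ℂ) • brickState b j y = f y := by
    rw [hf, brickState_eq_chainBasis hy (by rw [h, chainQuanta_eq])]
  rw [chainState_eq_chainBasis_add, chainBasis, chainBrick_eq]
  simp only [← hf]
  clear hf
  cases F <;> simp only [dressedState, maxCubic, leadingBrick, parity] at hterm ⊢
  case g1 | f2 =>
    rw [sum_range_two_mul_reflect]
    refine congrArg (_ + ·) (Finset.sum_congr rfl fun p hp ↦ ?_)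
    rw [Finset.mem_Icc] at hp
    congr 1 <;>
      exact hterm _ _ _ (by omega) (by simp only [brickQuanta, FermionicBrick.bosons]; omega)
  all_goals rw [sum_range_two_mul_add_one_reflect, add_assoc]
  case' g2 => rw [← sum_Icc_one_succ_reflect]
  case g2 | f1 =>
    refine congrArg (_ + ·) (congrArg₂ (· + ·) ?_ ?_) <;>
      refine Finset.sum_congr rfl fun p hp ↦ ?_ <;> rw [Finset.mem_Icc] at hp <;>
      exact hterm _ _ _ (by omega) (by simp only [brickQuanta, FermionicBrick.bosons]; omega)

end FamilyType

namespace FamilyType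

theorem exists_leadingBrick_maxCubic_eq (b : FermionicBrick) (m : ℕ) :
    ∃ (F : FamilyType) (κ : ℕ), F.leadingBrick = b ∧ F.maxCubic κ = m := by
  rcases Nat.even_or_odd' m with ⟨κ, rfl | rfl⟩ <;> cases b
  · exact ⟨g1, κ, rfl, rfl⟩
  · exact ⟨f2, κ, rfl, rfl⟩
  · exact ⟨f1, κ, rfl, rfl⟩
  · exact ⟨g2, κ, rfl, rfl⟩

theorem eq_of_leadingBrick_maxCubic_eq {F F' : FamilyType} {κ κ' : ℕ}
    (hb : F.leadingBrick = F'.leadingBrick) (hm : F.maxCubic κ = F'.maxCubic κ') :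
    F = F' ∧ κ = κ' := by
  cases F <;> cases F' <;> simp [leadingBrick, maxCubic] at hb hm ⊢ <;> omega

/-- The labels of the basis states that may occur in the states of the family: those with the
parity of the family and at most `F.maxCubic κ` cubic bricks. -/
def labels (F : FamilyType) (κ : ℕ) : Set BrickLabel :=
  {s | s.parity = F.parity ∧ s.2.2 ≤ F.maxCubic κ}

/-- The labels in `F.labels κ` with the maximal number of cubic bricks. -/
def leadingLabels (F : FamilyType) (κ : ℕ) : Set BrickLabel :=
  {s | s.1 = F.leadingBrick ∧ s.2.2 = F.maxCubic κ}

theorem mem_leadingLabels_iff {F : FamilyType} {κ : ℕ} {s : BrickLabel} :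
    s ∈ F.leadingLabels κ ↔ s.parity = F.parity ∧ s.2.2 = F.maxCubic κ := by
  obtain ⟨b, n, m⟩ := s
  refine and_congr_left fun hm : m = F.maxCubic κ ↦ ?_
  rw [← F.chainBrick_eq κ, ← hm]
  constructor
  · rintro rfl
    exact BrickLabel.parity_chainBrick _ _ _
  · intro hP
    rw [← hP, BrickLabel.chainBrick_parity]

theorem leadingLabels_subset (F : FamilyType) (κ : ℕ) : F.leadingLabels κ ⊆ F.labels κ :=
  fun _ hs ↦ (mem_leadingLabels_iff.1 hs).imp_right le_of_eq

theorem mem_labels_diff_leadingLabels {F : FamilyType} {κ : ℕ} {s : BrickLabel} :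
    s ∈ F.labels κ \ F.leadingLabels κ ↔ s.parity = F.parity ∧ s.2.2 < F.maxCubic κ := by
  rw [Set.mem_sdiff, mem_leadingLabels_iff, lt_iff_le_and_ne, labels, Set.mem_ofPred_eq]
  tauto

theorem contains_iff_exists_linearCombination {F : FamilyType} {κ : ℕ} {ψ : OneFermionFock} :
    F.Contains κ ψ ↔ ∃ c, ψ = Finsupp.linearCombination ℂ BrickLabel.basis c ∧
      ↑c.support ⊆ F.labels κ ∧ ¬ ↑c.support ⊆ F.labels κ \ F.leadingLabels κ := by
  refine exists_congr fun c ↦ and_congr Iff.rfl ⟨?_, ?_⟩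
  · rintro ⟨hc, s, hs, hm⟩
    refine ⟨fun t ht ↦ ⟨(BrickLabel.parity_eq_iff _ _).2 (hc t ht).1, (hc t ht).2.1⟩,
      fun hsub ↦ (hsub hs).2 ⟨(hc s hs).2.2 hm, hm⟩⟩
  · rintro ⟨hc, hnot⟩
    refine ⟨fun s hs ↦ ⟨(BrickLabel.parity_eq_iff _ _).1 (hc hs).1, (hc hs).2,
      fun hm ↦ (mem_leadingLabels_iff.2 ⟨(hc hs).1, hm⟩).1⟩, ?_⟩
    obtain ⟨s, hs, hlead⟩ := Set.not_subset.1 hnot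
    by_contra! hne
    exact hlead ⟨hc hs, fun h ↦ hne s hs h.2⟩

theorem contains_iff {F : FamilyType} {κ : ℕ} {ψ : OneFermionFock} :
    F.Contains κ ψ ↔
      ψ ∈ Submodule.span ℂ (BrickLabel.dressed '' F.labels κ) ∧
      ψ ∉ Submodule.span ℂ (BrickLabel.dressed '' (F.labels κ \ F.leadingLabels κ)) := by
  rw [BrickLabel.span_image_dressed, BrickLabel.span_image_dressed,
    contains_iff_exists_linearCombination]
  · constructor
    · rintro ⟨c, rfl, h⟩
      simpa only [linearCombination_mem_span_image_iff BrickLabel.basis_linearIndependent]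
    · rintro ⟨hmem, hnot⟩
      obtain ⟨c, hc, rfl⟩ := (Finsupp.mem_span_image_iff_linearCombination ℂ).1 hmem
      rw [linearCombination_mem_span_image_iff BrickLabel.basis_linearIndependent] at hnot
      exact ⟨c, rfl, hc, hnot⟩
  · intro s hs t hP _ hlt
    rw [mem_labels_diff_leadingLabels] at hs ⊢
    exact ⟨hP.trans hs.1, hlt.trans hs.2⟩
  · exact fun s hs t hP _ hlt ↦ ⟨hP.trans hs.1, hlt.le.trans hs.2⟩

theorem pos_of_mem_energies {N : ℕ} {F : FamilyType} {κ : ℕ} {E : ℝ} (hE : E ∈ F.energies N κ) :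
    0 < E := by
  by_contra! h
  exact (soninePoly_eval_pos (F.upperIndex κ) (F.solutionCount N κ)
    (show 2 * E ≤ 0 by linarith)).ne' hE

theorem encard_energies (N : ℕ) (F : FamilyType) (κ : ℕ) :
    (F.energies N κ).encard = F.solutionCount N κ := by
  have hroots : F.energies N κ = (fun x : ℝ ↦ 2 * x) ⁻¹'
      (soninePoly (F.upperIndex κ) (F.solutionCount N κ)).roots.toFinset := by
    ext E
    simp [energies, soninePoly_ne_zero]
  rw [hroots, Set.encard_preimage_of_bijective (mulLeft_bijective₀ 2 two_ne_zero),
    Set.encard_coe_eq_coe_finsetCard, card_toFinset_roots_soninePoly]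

theorem aeval_two_mul_ofReal (p : Polynomial ℝ) (x : ℝ) :
    Polynomial.aeval (2 * x : ℂ) p = p.eval (2 * x) := by
  simpa using Polynomial.aeval_algebraMap_apply_eq_algebraMap_eval (A := ℂ) (2 * x) p

theorem exists_mem_energies_iff {N : ℕ} {F : FamilyType} {κ : ℕ} {E : ℂ} :
    (∃ x ∈ F.energies N κ, (x : ℂ) = E) ↔
      Polynomial.aeval (2 * E) (soninePoly (F.upperIndex κ) (F.solutionCount N κ)) = 0 := by
  constructor
  · rintro ⟨x, hx, rfl⟩
    rw [aeval_two_mul_ofReal, Complex.ofReal_eq_zero]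
    exact hx
  · intro h
    obtain ⟨y, hy⟩ := (splits_soninePoly _ _).mem_range_of_isRoot (soninePoly_ne_zero _ _)
      (i := algebraMap ℝ ℂ) (x := 2 * E)
      (by simpa [Polynomial.aeval_def, Polynomial.eval_map] using h)
    have hE : E = (y / 2 : ℝ) := by
      rw [Complex.ofReal_div, eq_div_iff (by simp)]
      simpa [mul_comm] using hy.symm
    refine ⟨y / 2, ?_, hE.symm⟩
    rw [hE, aeval_two_mul_ofReal, Complex.ofReal_eq_zero] at h
    exact h

theorem exists_eigenstate_eq_smul {N : ℕ} {F : FamilyType} {κ : ℕ} {E : ℝ}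
    (hE : E ∈ F.energies N κ) : ∃ c : ℂ, c ≠ 0 ∧ F.eigenstate N κ E =
      c • chainVector F.parity (F.maxCubic κ) (F.solutionCount N κ) E := by
  have hpos : 0 < 2 * E := mul_pos two_pos (pos_of_mem_energies hE)
  refine ⟨((2 * E) ^ F.normExponent κ * Real.exp (-E) : ℝ), ?_, ?_⟩
  · rw [Complex.ofReal_ne_zero]
    positivity
  · simp only [eigenstate, chainVector, chainIndex_eq, dressedState_eq, aeval_two_mul_ofReal]

theorem isCutEigenstate_eigenstate {N : ℕ} {F : FamilyType} {κ : ℕ} {E : ℝ}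
    (hE : E ∈ F.energies N κ) : IsCutEigenstate N E (F.eigenstate N κ E) := by
  have hz := exists_mem_energies_iff.1 ⟨E, hE, rfl⟩
  obtain ⟨c, hc, h⟩ := exists_eigenstate_eq_smul hE
  rw [← chainCount_eq] at h hz
  rw [← chainIndex_eq] at hz
  rw [h]
  refine ⟨Submodule.smul_mem _ _ (chainVector_mem_cutSpace _ _ _), smul_ne_zero hc
    (chainVector_ne_zero (pos_of_aeval_soninePoly_eq_zero hz) _), ?_⟩
  rw [map_smul, map_smul, quantaCutoff_hamiltonian_chainVector hz, smul_comm]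

end FamilyType

namespace FamilyType

theorem dressed_leadingLabel (F : FamilyType) (κ n : ℕ) :
    BrickLabel.dressed (F.leadingBrick, n, F.maxCubic κ) = F.dressedState κ n := by
  rw [dressedState_eq, ← F.chainBrick_eq κ, BrickLabel.dressed_chainBrick]

theorem eigenstate_mem_span_dressedState (N : ℕ) (F : FamilyType) (κ : ℕ) (E : ℝ) :
    F.eigenstate N κ E ∈
      Submodule.span ℂ (Set.range fun n : Fin (F.solutionCount N κ) ↦ F.dressedState κ n) :=
  Submodule.smul_mem _ _ <| Submodule.sum_mem _ fun n hn ↦ Submodule.smul_mem _ _ <|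
    Submodule.subset_span ⟨⟨n, Finset.mem_range.1 hn⟩, rfl⟩

theorem eigenstate_mem_span_dressed (N : ℕ) (F : FamilyType) (κ : ℕ) (E : ℝ) :
    F.eigenstate N κ E ∈ Submodule.span ℂ (BrickLabel.dressed '' F.leadingLabels κ) := by
  refine Submodule.span_mono ?_ (eigenstate_mem_span_dressedState N F κ E)
  rintro _ ⟨n, rfl⟩
  exact ⟨(F.leadingBrick, n, F.maxCubic κ), ⟨rfl, rfl⟩, F.dressed_leadingLabel κ n⟩

theorem contains_eigenstate {N : ℕ} {F : FamilyType} {κ : ℕ} {E : ℝ}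
    (hE : E ∈ F.energies N κ) : F.Contains κ (F.eigenstate N κ E) := by
  have hmem := eigenstate_mem_span_dressed N F κ E
  refine contains_iff.2 ⟨Submodule.span_mono (Set.image_mono (F.leadingLabels_subset κ)) hmem,
    fun hlower ↦ (isCutEigenstate_eigenstate hE).2.1 ?_⟩
  exact Submodule.disjoint_def.1 (BrickLabel.dressed_linearIndependent.disjoint_span_image
    Set.disjoint_sdiff_right) _ hmem hlower

theorem finite_energies (N : ℕ) (F : FamilyType) (κ : ℕ) : Finite (F.energies N κ) :=
  Set.finite_of_encard_eq_coe (encard_energies N F κ)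

theorem natCard_energies (N : ℕ) (F : FamilyType) (κ : ℕ) :
    Nat.card (F.energies N κ) = F.solutionCount N κ := by
  rw [Nat.card_coe_set_eq, Set.ncard, encard_energies, ENat.toNat_natCast]

theorem eigenstate_linearIndependent (N : ℕ) (F : FamilyType) (κ : ℕ) :
    LinearIndependent ℂ fun E : F.energies N κ ↦ F.eigenstate N κ E := by
  refine Module.End.eigenvectors_linearIndependent' (quantaCutoff N ∘ₗ hamiltonian)
    (fun E : F.energies N κ ↦ ((E : ℝ) : ℂ))
    (Complex.ofReal_injective.comp Subtype.val_injective) _ fun E ↦ ?_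
  obtain ⟨-, hne, heig⟩ := isCutEigenstate_eigenstate E.2
  exact ⟨Module.End.mem_eigenspace_iff.2 heig, hne⟩

theorem span_eigenstate (N : ℕ) (F : FamilyType) (κ : ℕ) :
    Submodule.span ℂ (Set.range fun E : F.energies N κ ↦ F.eigenstate N κ E) =
      Submodule.span ℂ (Set.range fun n : Fin (F.solutionCount N κ) ↦ F.dressedState κ n) := by
  have := finite_energies N F κ
  have := Fintype.ofFinite (F.energies N κ)
  have := FiniteDimensional.span_of_finite ℂ (Set.finite_range
    fun n : Fin (F.solutionCount N κ) ↦ F.dressedState κ n)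
  refine Submodule.eq_of_le_of_finrank_le ?_ ?_
  · rw [Submodule.span_le]
    rintro _ ⟨E, rfl⟩
    exact eigenstate_mem_span_dressedState N F κ E
  · rw [finrank_span_eq_card (eigenstate_linearIndependent N F κ), ← Nat.card_eq_fintype_card,
      natCard_energies]
    exact (finrank_range_le_card _).trans (Fintype.card_fin _).le

theorem disjoint_leadingLabels {p q : FamilyType × ℕ} (h : p ≠ q) :
    Disjoint (p.1.leadingLabels p.2) (q.1.leadingLabels q.2) := by
  refine Set.disjoint_left.2 fun s hp hq ↦ h ?_
  exact Prod.ext_iff.2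
    (eq_of_leadingBrick_maxCubic_eq (hp.1.symm.trans hq.1) (hp.2.symm.trans hq.2))

theorem sigma_eigenstate_linearIndependent (N : ℕ) :
    LinearIndependent ℂ fun t : Σ p : FamilyType × ℕ, p.1.energies N p.2 ↦
      t.1.1.eigenstate N t.1.2 t.2 := by
  have hspan (p : FamilyType × ℕ) :
      Submodule.span ℂ (Set.range fun E : p.1.energies N p.2 ↦ p.1.eigenstate N p.2 E) ≤
        Submodule.span ℂ (BrickLabel.dressed '' p.1.leadingLabels p.2) := by
    rw [Submodule.span_le]
    rintro _ ⟨E, rfl⟩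
    exact eigenstate_mem_span_dressed N p.1 p.2 E
  refine linearIndependent_iUnion_finite (R := ℂ)
    (ιs := fun p : FamilyType × ℕ ↦ p.1.energies N p.2)
    (f := fun p E ↦ p.1.eigenstate N p.2 E) (fun p ↦ eigenstate_linearIndependent N p.1 p.2)
    fun p t _ hp ↦ ?_
  refine (BrickLabel.dressed_linearIndependent.disjoint_span_image
    (disjoint_compl_right (a := p.1.leadingLabels p.2))).mono (hspan p) (iSup₂_le fun q hq ↦ ?_)
  refine (hspan q).trans (Submodule.span_mono (Set.image_mono ?_))
  exact (disjoint_leadingLabels (ne_of_mem_of_not_mem hq hp)).subset_compl_right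

end FamilyType

open FamilyType

theorem span_cutSolution (N : ℕ) : Submodule.span ℂ
    (Set.range fun s : CutSolution N ↦ s.1.1.eigenstate N s.1.2.1 s.1.2.2) = cutSpace N := by
  apply le_antisymm
  · rw [Submodule.span_le]
    rintro _ ⟨s, rfl⟩
    exact (isCutEigenstate_eigenstate s.2).1
  · rw [cutSpace_eq_span_image_dressed, Submodule.span_le]
    rintro _ ⟨⟨b, n, m⟩, hs, rfl⟩
    obtain ⟨F, κ, rfl, rfl⟩ := exists_leadingBrick_maxCubic_eq b m
    have hn : n < F.solutionCount N κ := by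
      rw [← chainCount_eq, lt_chainCount_iff, chainQuanta, chainBrick_eq]
      exact hs
    have hmem : F.dressedState κ n ∈ Submodule.span ℂ (Set.range
        fun E : F.energies N κ ↦ F.eigenstate N κ E) := by
      rw [span_eigenstate]
      exact Submodule.subset_span ⟨⟨n, hn⟩, rfl⟩
    rw [F.dressed_leadingLabel]
    refine Submodule.span_mono ?_ hmem
    rintro _ ⟨E, rfl⟩
    exact ⟨⟨(F, κ, E), E.2⟩, rfl⟩

theorem cutSolution_linearIndependent (N : ℕ) : LinearIndependent ℂ
    fun s : CutSolution N ↦ s.1.1.eigenstate N s.1.2.1 s.1.2.2 := by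
  have hinj : Function.Injective fun s : CutSolution N ↦
      (⟨(s.1.1, s.1.2.1), s.1.2.2, s.2⟩ : Σ p : FamilyType × ℕ, p.1.energies N p.2) := by
    rintro ⟨⟨F, κ, E⟩, hE⟩ ⟨⟨F', κ', E'⟩, hE'⟩ h
    cases h
    rfl
  exact ((sigma_eigenstate_linearIndependent N).comp _ hinj :)

theorem mem_span_of_isCutEigenstate {N : ℕ} {E : ℂ} {ψ : OneFermionFock}
    (h : IsCutEigenstate N E ψ) : ψ ∈ Submodule.span ℂ {φ | ∃ (F : FamilyType) (κ : ℕ),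
      ∃ x ∈ F.energies N κ, (x : ℂ) = E ∧ φ = F.eigenstate N κ x} := by
  obtain ⟨hψ, -, heig⟩ := h
  rw [← span_cutSolution] at hψ
  refine Submodule.span_mono ?_ (mem_span_image_of_apply_eq_smul
    (T := quantaCutoff N ∘ₗ hamiltonian) (μ := fun s : CutSolution N ↦ (s.1.2.2 : ℂ))
    (cutSolution_linearIndependent N) (fun s ↦ (isCutEigenstate_eigenstate s.2).2.2) hψ heig)
  rintro _ ⟨s, hs, rfl⟩
  exact ⟨s.1.1, s.1.2.1, s.1.2.2, s.2, hs, rfl⟩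

theorem exists_mem_energies_of_contains {N : ℕ} {F : FamilyType} {κ : ℕ} {E : ℂ}
    {ψ : OneFermionFock} (h : IsCutEigenstate N E ψ) (hc : F.Contains κ ψ) :
    ∃ x ∈ F.energies N κ, E = x := by
  by_contra! hno
  obtain ⟨hmem, hnot⟩ := contains_iff.1 hc
  have hcompl : ψ ∈ Submodule.span ℂ (BrickLabel.dressed '' (F.leadingLabels κ)ᶜ) := by
    refine Submodule.span_le.2 ?_ (mem_span_of_isCutEigenstate h)
    rintro _ ⟨F', κ', x, hx, hxE, rfl⟩
    have hne : (F', κ') ≠ (F, κ) := by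
      rintro ⟨⟩
      exact hno x hx hxE.symm
    exact Submodule.span_mono (Set.image_mono (disjoint_leadingLabels hne).subset_compl_right)
      (eigenstate_mem_span_dressed N F' κ' x)
  refine hnot ?_
  rw [Set.sdiff_eq, ← span_image_inf_span_image BrickLabel.dressed_linearIndependent]
  exact ⟨hmem, hcompl⟩

theorem exists_isCutEigenstate_iff {N : ℕ} {E : ℂ} : (∃ ψ, IsCutEigenstate N E ψ) ↔
    ∃ (F : FamilyType) (κ : ℕ), ∃ x ∈ F.energies N κ, (x : ℂ) = E := by
  constructor
  · rintro ⟨ψ, h⟩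
    by_contra! hno
    refine h.2.1 ((Submodule.mem_bot ℂ).1 (Submodule.span_le.2 ?_ (mem_span_of_isCutEigenstate h)))
    rintro _ ⟨F, κ, x, hx, hxE, -⟩
    exact absurd hxE (hno F κ x hx)
  · rintro ⟨F, κ, x, hx, rfl⟩
    exact ⟨_, isCutEigenstate_eigenstate hx⟩

theorem aeval_thetaPoly_eq_zero_iff {N : ℕ} {E : ℂ} :
    Polynomial.aeval E (thetaPoly N) = 0 ↔
      ∃ (b : FermionicBrick) (m : ℕ), Polynomial.aeval (2 * E)
        (soninePoly (3 * m + 3 + b.bosons) ((N + 2 - (3 * m + b.bosons)) / 2)) = 0 := by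
  have hfa (m : ℕ) : (((N : ℤ) - 3 * m - 1) / 2 + 1).toNat = (N + 2 - (3 * m + 1)) / 2 := by
    omega
  have hfaa (m : ℕ) : (((N : ℤ) - 3 * m - 2) / 2 + 1).toNat = (N + 2 - (3 * m + 2)) / 2 := by
    omega
  simp only [thetaPoly, map_mul, map_prod, mul_eq_zero, Finset.prod_eq_zero_iff, hfa, hfaa,
    Finset.mem_range, Polynomial.aeval_comp, Polynomial.aeval_X, map_ofNat]
  constructor
  · rintro (⟨m, -, h⟩ | ⟨m, -, h⟩)
    · exact ⟨.fa, m, h⟩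
    · exact ⟨.faa, m, h⟩
  · rintro ⟨b, m, h⟩
    have hpos := pos_of_aeval_soninePoly_eq_zero h
    cases b with
    | fa =>
      simp only [FermionicBrick.bosons] at hpos
      exact Or.inl ⟨m, by omega, h⟩
    | faa =>
      simp only [FermionicBrick.bosons] at hpos
      exact Or.inr ⟨m, by omega, h⟩

theorem mainTheorem2 (N : ℕ) :
    -- the states built with the bricks are linearly independent
    LinearIndependent ℂ
      (fun s : FermionicBrick × ℕ × ℕ => brickState s.1 s.2.1 s.2.2) ∧
    -- the quantization condition of each family has as many solutions as stated, all positive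
    (∀ (F : FamilyType) (κ : ℕ),
      (F.energies N κ).encard = F.solutionCount N κ ∧ ∀ E ∈ F.energies N κ, 0 < E) ∧
    -- each energy of a family comes with the explicit eigenstate, which belongs to the family
    (∀ (F : FamilyType) (κ : ℕ), ∀ E ∈ F.energies N κ,
      IsCutEigenstate N E (F.eigenstate N κ E) ∧ F.Contains κ (F.eigenstate N κ E)) ∧
    -- eigenstates of a family occur only at its quantized energies
    (∀ (F : FamilyType) (κ : ℕ) (E : ℂ) (ψ : OneFermionFock),
      IsCutEigenstate N E ψ → F.Contains κ ψ → ∃ x ∈ F.energies N κ, E = x) ∧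
    -- the solutions of all families together form a basis of the cut-off space
    LinearIndependent ℂ
      (fun s : CutSolution N => s.1.1.eigenstate N s.1.2.1 s.1.2.2) ∧
    Submodule.span ℂ
      (Set.range fun s : CutSolution N => s.1.1.eigenstate N s.1.2.1 s.1.2.2) = cutSpace N ∧
    -- every eigenstate of energy `E` is a combination of the solutions of energy `E`
    (∀ (E : ℂ) (ψ : OneFermionFock), IsCutEigenstate N E ψ →
      ψ ∈ Submodule.span ℂ {φ | ∃ (F : FamilyType) (κ : ℕ), ∃ x ∈ F.energies N κ,
        (x : ℂ) = E ∧ φ = F.eigenstate N κ x}) ∧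
    -- the spectrum is the set of roots of the product of Laguerre polynomials
    {E : ℂ | ∃ ψ, IsCutEigenstate N E ψ} = {E : ℂ | Polynomial.aeval E (thetaPoly N) = 0} := by
  refine ⟨brickState_linearIndependent,
    fun F κ ↦ ⟨encard_energies N F κ, fun E hE ↦ pos_of_mem_energies hE⟩,
    fun F κ E hE ↦ ⟨isCutEigenstate_eigenstate hE, contains_eigenstate hE⟩,
    fun F κ E ψ h hc ↦ exists_mem_energies_of_contains h hc,
    cutSolution_linearIndependent N, span_cutSolution N,
    fun E ψ h ↦ mem_span_of_isCutEigenstate h, ?_⟩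
  ext E
  change (∃ ψ, IsCutEigenstate N E ψ) ↔ Polynomial.aeval E (thetaPoly N) = 0
  rw [exists_isCutEigenstate_iff, aeval_thetaPoly_eq_zero_iff]
  simp only [exists_mem_energies_iff, upperIndex_eq, solutionCount_eq]
  constructor
  · rintro ⟨F, κ, h⟩
    exact ⟨F.leadingBrick, F.maxCubic κ, h⟩
  · rintro ⟨b, m, h⟩
    obtain ⟨F, κ, rfl, rfl⟩ := exists_leadingBrick_maxCubic_eq b m
    exact ⟨F, κ, h⟩
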